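/- **Theorem 3.3.** Let $\{x_t\}_{t\in\mathbb Z}$ be an $\mathbb R^d$-valued strictly stationary, ergodic sequence with square-integrable coordinates such that, for some $c>0$ and $\zeta>2$, $|\mathrm{cov}(x_0(i),x_t(i))|\le c(t+1)^{-\zeta}$ for all $t\ge 0$ and $1\le i\le d$, where $x_t(i)$ is the $i$-th coordinate of $x_t$. Let $\Theta\subset\mathbb R$ be a compact set with finitely many connected components (for instance a compact interval), let $g:\mathbb R^d\times\Theta\to\mathbb R$ be measurable in its first argument, and put $m_t(\theta)=g(x_t,\theta)$. Derivatives in $\theta$ are taken relative to $\Theta$ (one-sided at end points; no condition at isolated points of $\Theta$, where the derivative is set to be $0$). Suppose: 1. (Stability, $H_0$, and identifiability) $Em_t(\theta_0)=0$ for all $t\ge1$ for a unique $\theta_0\in\Theta$, and for $\theta\in\Theta$, $Em_0(\theta)=0$ if and only if $\theta=\theta_0$. 2. (Regularity) $\sup_{\theta\in\Theta}E|m_0(\theta)|<\infty$; each $m_t(\cdot)$ is almost surely differentiable on $\Theta$; almost surely $\sup_{\theta\in\Theta}\left|\frac{\partial}{\partial\theta}m_0(\theta)\right|\le M_0$ for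 a random variable $M_0$ with $EM_0<\infty$; and $E\frac{\partial}{\partial\theta}m_0(\theta)\ne0$ for all $\theta\in\Theta$ in a neighbourhood of $\theta_0$. 3. (Strong approximation) There are $\sigma>0$, $0<\kappa<1/2$ and, for each $T$, independent Wiener processes $\{W_{T,1}(x),0\le x\le T/2\}$ and $\{W_{T,2}(x),0\le x\le T/2\}$ such that, as $T\to\infty$, $$\sup_{1\le x\le T/2}x^{-\kappa}\Big|\sum_{s=1}^{\lfloor x\rfloor}m_s(\theta_0)-\sigma W_{T,1}(x)\Big|=O_P(1),\qquad \sup_{T/2\le x\le T-1}(T-x)^{-\kappa}\Big|\sum_{s=\lfloor x\rfloor+1}^{T}m_s(\theta_0)-\sigma W_{T,2}(T-x)\Big|=O_P(1).$$ 4. (Estimator) $\hat\theta_T$ is a $\Theta$-valued random variable satisfying $\sum_{t=1}^Tm_t(\hat\theta_T)=0$ with probability tending to one as $T\to\infty$. 5. (Trimming) $t_T$ are real numbers with $t_T\to\infty$ and $t_T/T\to0$ as $T\to\infty$. Then, as $T\to\infty$, $$\frac{t_T^{1/2}}{\sigma}\max_{t_T\le t\le T-t_T}\left|\frac1t\sum_{s=1}^tm_s(\hat\theta_T)-\frac1{T-t}\sum_{s=t+1}^Tm_s(\hat\theta_T)\right|\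 \xrightarrow{\ \mathcal D\ }\ \max(\xi_1,\xi_2),$$ where the maximum is over integers $t$, and $\xi_1,\xi_2$ are independent, each distributed as $\xi=\sup_{0\le u\le1}|W(u)|$ with $\{W(u),0\le u\le1\}$ a Wiener process. -/

import Mathlib

open MeasureTheory ProbabilityTheory Filter Topology
open scoped ENNReal NNReal

namespace GMM

variable {Ω : Type*} [MeasurableSpace Ω]

/-- `W` restricted to the index set `[0, S]` is a Wiener process (standard Brownian motion): its
finite-dimensional distributions at times in `[0, S]` are those of Brownian motion (centered
Gaussian with covariance `min s t`) and its paths are almost surely continuous on `[0, S]`. -/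
structure IsWienerOn (P : Measure Ω) (S : ℝ≥0) (W : ℝ≥0 → Ω → ℝ) : Prop where
  hasLaw : ∀ I : Finset ℝ≥0, (∀ u ∈ I, u ≤ S) →
    HasLaw (fun ω ↦ I.restrict (W · ω)) (BrownianReal.projectiveFamily I) P
  cont : ∀ᵐ ω ∂P, ContinuousOn (W · ω) (Set.Icc 0 S)

/-- A Brownian motion on the half-line is a Wiener process on every `[0, S]`. -/
theorem isWienerOn_of_isBrownianReal {P : Measure Ω} {W : ℝ≥0 → Ω → ℝ}
    (h : IsBrownianReal W P) (S : ℝ≥0) : IsWienerOn P S W where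
  hasLaw I _ := h.toIsPreBrownianReal.hasLaw I
  cont := by
    filter_upwards [h.cont] with ω hω using hω.continuousOn

/-- `Z_T = O_P(1)` as `T → ∞`, for a sequence of `[0, ∞]`-valued functions on `Ω`. -/
def IsBigOP (P : Measure Ω) (Z : ℕ → Ω → ℝ≥0∞) : Prop :=
  ∀ ε : ℝ≥0∞, 0 < ε → ∃ C : ℝ≥0, ∀ᶠ T in atTop, P {ω | (C : ℝ≥0∞) < Z T ω} ≤ ε

/-- The trimming condition: `t_T → ∞` and `t_T / T → 0`. -/
structure TrimmingCondition (t : ℕ → ℝ) : Prop where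
  tendsto_atTop : Tendsto t atTop atTop
  tendsto_div : Tendsto (fun T : ℕ ↦ t T / (T : ℝ)) atTop (𝓝 0)

/-- The process `x` is (strictly) stationary and ergodic, i.e. its law on the path space is
preserved by the shift (this is part of `Ergodic`) and the shift is ergodic for it; its coordinates
are square integrable, and the autocovariances of each coordinate decay at a polynomial rate
`ζ > 2`. -/
structure StationaryErgodicDecay (P : Measure Ω) {d : ℕ}
    (x : ℤ → Ω → EuclideanSpace ℝ (Fin d)) : Prop where
  ergodic : Ergodic (fun (y : ℤ → EuclideanSpace ℝ (Fin d)) (t : ℤ) ↦ y (t + 1))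
    (P.map (fun ω t ↦ x t ω))
  memLp : ∀ t i, MemLp (fun ω ↦ x t ω i) 2 P
  cov_decay : ∃ c ζ : ℝ, 0 < c ∧ 2 < ζ ∧ ∀ (t : ℕ) (i : Fin d),
    |covariance (fun ω ↦ x 0 ω i) (fun ω ↦ x t ω i) P| ≤ c * ((t : ℝ) + 1) ^ (-ζ)

/-- The moment functions `m_t(θ) = g(x_t, θ)`. -/
def moment {d : ℕ} (g : EuclideanSpace ℝ (Fin d) → ℝ → ℝ)
    (x : ℤ → Ω → EuclideanSpace ℝ (Fin d)) (t : ℤ) (θ : ℝ) (ω : Ω) : ℝ :=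
  g (x t ω) θ

/-- The stability hypothesis: `0 = E m_1(θ₀) = E m_2(θ₀) = ⋯` for a unique `θ₀ ∈ Θ`. -/
structure NullHypothesis (P : Measure Ω) (Θ : Set ℝ) (m : ℤ → ℝ → Ω → ℝ) (θ₀ : ℝ) : Prop where
  mem : θ₀ ∈ Θ
  moment_eq : ∀ t : ℕ, 1 ≤ t → ∫ ω, m t θ₀ ω ∂P = 0
  unique : ∀ θ ∈ Θ, (∀ t : ℕ, 1 ≤ t → ∫ ω, m t θ ω ∂P = 0) → θ = θ₀

/-- Identifiability: for `θ ∈ Θ`, `E m_0(θ) = 0` if and only if `θ = θ₀`. -/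
def Identifiable (P : Measure Ω) (Θ : Set ℝ) (m : ℤ → ℝ → Ω → ℝ) (θ₀ : ℝ) : Prop :=
  ∀ θ ∈ Θ, (∫ ω, m 0 θ ω ∂P = 0) ↔ θ = θ₀

/-- Regularity of the moment functions: a uniform first moment bound, differentiability in `θ` on
`Θ` (one-sided at end points), an integrable bound `M` on the derivative, and a mean derivative
which does not vanish on a neighbourhood of `θ₀` in `Θ`. Derivatives are relative to `Θ`, so they
impose nothing at isolated points of `Θ`, where Mathlib sets `derivWithin` to be `0`. -/
structure MomentRegularity (P : Measure Ω) (Θ : Set ℝ) (m : ℤ → ℝ → Ω → ℝ) (θ₀ : ℝ) : Prop where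
  integrable : ∀ θ ∈ Θ, Integrable (m 0 θ) P
  bound : ∃ C : ℝ, ∀ θ ∈ Θ, ∫ ω, |m 0 θ ω| ∂P ≤ C
  differentiable : ∀ t, ∀ᵐ ω ∂P, DifferentiableOn ℝ (fun θ ↦ m t θ ω) Θ
  deriv_bound : ∃ M : Ω → ℝ, Integrable M P ∧
    ∀ᵐ ω ∂P, ∀ θ ∈ Θ, |derivWithin (fun θ' ↦ m 0 θ' ω) Θ θ| ≤ M ω
  deriv_ne_zero : ∀ᶠ θ in 𝓝[Θ] θ₀, ∫ ω, derivWithin (fun θ' ↦ m 0 θ' ω) Θ θ ∂P ≠ 0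

/-- Strong approximation of the partial sums of `e_1, …, e_T` from both ends of the sample, with
rate `κ < 1/2`, by independent Wiener processes on `[0, T/2]` scaled by `σ`. -/
def StrongApproximation (P : Measure Ω) (e : ℤ → Ω → ℝ) (σ : ℝ) : Prop :=
  ∃ κ : ℝ, 0 < κ ∧ κ < 1 / 2 ∧ ∃ W₁ W₂ : ℕ → ℝ≥0 → Ω → ℝ,
    (∀ T : ℕ, IsWienerOn P ((T : ℝ≥0) / 2) (W₁ T)) ∧
    (∀ T : ℕ, IsWienerOn P ((T : ℝ≥0) / 2) (W₂ T)) ∧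
    (∀ T : ℕ, IndepFun (fun ω (u : Set.Icc (0 : ℝ≥0) ((T : ℝ≥0) / 2)) ↦ W₁ T u ω)
      (fun ω (u : Set.Icc (0 : ℝ≥0) ((T : ℝ≥0) / 2)) ↦ W₂ T u ω) P) ∧
    IsBigOP P (fun T ω ↦ ⨆ x ∈ Set.Icc (1 : ℝ≥0) ((T : ℝ≥0) / 2),
      ENNReal.ofReal ((x : ℝ) ^ (-κ) *
        |(∑ s ∈ Finset.Icc 1 ⌊x⌋₊, e (s : ℤ) ω) - σ * W₁ T x ω|)) ∧
    IsBigOP P (fun T ω ↦ ⨆ x ∈ Set.Icc ((T : ℝ≥0) / 2) ((T : ℝ≥0) - 1),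
      ENNReal.ofReal (((T : ℝ) - (x : ℝ)) ^ (-κ) *
        |(∑ s ∈ Finset.Icc (⌊x⌋₊ + 1) T, e (s : ℤ) ω) - σ * W₂ T ((T : ℝ≥0) - x) ω|))

/-- `θhat T` is a GMM estimator: a `Θ`-valued random variable which solves the moment equation
`∑_{t=1}^T m_t(θhat T) = 0` with probability tending to one as `T → ∞`. -/
structure IsGMMEstimator (P : Measure Ω) (Θ : Set ℝ) (m : ℤ → ℝ → Ω → ℝ)
    (θhat : ℕ → Ω → ℝ) : Prop where
  measurable : ∀ T, Measurable (θhat T)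
  mem : ∀ T ω, θhat T ω ∈ Θ
  solves : Tendsto
    (fun T : ℕ ↦ P {ω | ∑ t ∈ Finset.Icc 1 T, m (t : ℤ) (θhat T ω) ω ≠ 0}) atTop (𝓝 0)

/-- The difference of the averages of `X_1, …, X_t` and of `X_{t+1}, …, X_T`. -/
noncomputable def meanDiff (X : ℤ → ℝ) (T t : ℕ) : ℝ :=
  (1 / (t : ℝ)) * (∑ s ∈ Finset.Icc 1 t, X (s : ℤ))
    - (1 / ((T : ℝ) - (t : ℝ))) * ∑ s ∈ Finset.Icc (t + 1) T, X (s : ℤ)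

open scoped Classical in
/-- The Rényi statistic `max_{a ≤ t ≤ T - a} |meanDiff X T t|`, the maximum being over integers
`t` (and equal to `0` when there is no such `t`, which happens only for finitely many `T` under
the trimming condition). -/
noncomputable def renyi (X : ℤ → ℝ) (T : ℕ) (a : ℝ) : ℝ :=
  (((Finset.Icc 1 (T - 1)).filter (fun t : ℕ ↦ a ≤ (t : ℝ) ∧ (t : ℝ) ≤ (T : ℝ) - a)).sup
    (fun t ↦ ‖meanDiff X T t‖₊) : ℝ≥0)

end GMM

namespace GMM

section Whp

variable {Ω : Type*} [MeasurableSpace Ω] {P : Measure Ω}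

/-- The filter of events which hold with probability tending to one as the sample size tends to
infinity. Convergence along it is convergence in probability. -/
def whp (P : Measure Ω) : Filter (ℕ × Ω) where
  sets := {A | Tendsto (fun T ↦ P {ω | (T, ω) ∉ A}) atTop (𝓝 0)}
  univ_sets := by simp
  sets_of_superset {A B} hA hAB :=
    tendsto_of_tendsto_of_tendsto_of_le_of_le tendsto_const_nhds hA (fun _ ↦ zero_le)
      (fun _ ↦ measure_mono fun _ h h' ↦ h (hAB h'))
  inter_sets {A B} hA hB := by
    have h := Tendsto.add hA hB
    rw [add_zero] at h
    refine tendsto_of_tendsto_of_tendsto_of_le_of_le tendsto_const_nhds h (fun _ ↦ zero_le)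
      (fun T ↦ (measure_mono fun ω hω ↦ ?_).trans (measure_union_le _ _))
    simp only [Set.mem_inter_iff, Set.mem_union, Set.mem_ofPred_eq] at hω ⊢
    tauto

theorem eventually_whp_iff {p : ℕ × Ω → Prop} :
    (∀ᶠ q in whp P, p q) ↔ Tendsto (fun T ↦ P {ω | ¬ p (T, ω)}) atTop (𝓝 0) := Iff.rfl

theorem eventually_whp_of_ae {p : ℕ × Ω → Prop} (h : ∀ T, ∀ᵐ ω ∂P, p (T, ω)) :
    ∀ᶠ q in whp P, p q := by
  rw [eventually_whp_iff]
  simp_rw [ae_iff] at h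
  simp [h]

theorem tendsto_fst_whp : Tendsto Prod.fst (whp P) atTop := by
  intro A hA
  change ∀ᶠ q : ℕ × Ω in whp P, q.1 ∈ A
  rw [eventually_whp_iff]
  refine tendsto_const_nhds.congr' ?_
  filter_upwards [hA] with T hT
  simp [hT]

theorem eventually_whp_of_atTop {p : ℕ → Prop} (h : ∀ᶠ T in atTop, p T) :
    ∀ᶠ q in whp P, p q.1 := tendsto_fst_whp.eventually h

theorem tendsto_whp_of_atTop {α : Type*} {f : ℕ → α} {l : Filter α} (h : Tendsto f atTop l) :
    Tendsto (fun q : ℕ × Ω ↦ f q.1) (whp P) l := h.comp tendsto_fst_whp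

theorem tendstoInMeasure_of_whp {X : ℕ → Ω → ℝ} {c : ℝ}
    (h : Tendsto (fun q : ℕ × Ω ↦ X q.1 q.2) (whp P) (𝓝 c)) :
    TendstoInMeasure P X atTop fun _ ↦ c := by
  rw [tendstoInMeasure_iff_dist]
  intro ε hε
  have := eventually_whp_iff.1 (Metric.tendsto_nhds.1 h ε hε)
  simpa only [not_lt] using this

theorem tendsto_whp_of_tendstoInMeasure {X : ℕ → Ω → ℝ} {c : ℝ}
    (h : TendstoInMeasure P X atTop fun _ ↦ c) :
    Tendsto (fun q : ℕ × Ω ↦ X q.1 q.2) (whp P) (𝓝 c) := by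
  rw [tendstoInMeasure_iff_dist] at h
  rw [Metric.tendsto_nhds]
  intro ε hε
  rw [eventually_whp_iff]
  simpa only [not_lt] using h ε hε

/-- `X_T = O_P(1)` for real random variables `X_T = X (T, ·)`. -/
def BoundedInProb (P : Measure Ω) (X : ℕ × Ω → ℝ) : Prop :=
  ∀ ε : ℝ≥0∞, 0 < ε → ∃ C : ℝ, ∀ᶠ T in atTop, P {ω | C < |X (T, ω)|} ≤ ε

theorem BoundedInProb.mul_tendsto_zero {X Y : ℕ × Ω → ℝ} (hX : BoundedInProb P X)
    (hY : Tendsto Y (whp P) (𝓝 0)) : Tendsto (fun q ↦ X q * Y q) (whp P) (𝓝 0) := by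
  rw [Metric.tendsto_nhds] at hY ⊢
  intro δ hδ
  rw [eventually_whp_iff, ENNReal.tendsto_nhds_zero]
  intro ε hε
  obtain ⟨C, hC⟩ := hX (ε / 2) (ENNReal.half_pos hε.ne')
  have hpos : 0 < |C| + 1 := by positivity
  have h := ENNReal.tendsto_nhds_zero.1
    (eventually_whp_iff.1 (hY (δ / (|C| + 1)) (by positivity))) (ε / 2) (ENNReal.half_pos hε.ne')
  filter_upwards [hC, h] with T h1 h2
  refine (measure_mono (t := {ω | C < |X (T, ω)|} ∪
    {ω | ¬ dist (Y (T, ω)) 0 < δ / (|C| + 1)}) fun ω hω ↦ ?_).trans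
    ((measure_union_le _ _).trans ((add_le_add h1 h2).trans (ENNReal.add_halves _).le))
  simp only [Set.mem_union, Set.mem_ofPred_eq, dist_zero_right, Real.norm_eq_abs] at hω ⊢
  by_contra! hcon
  apply hω
  rw [abs_mul]
  calc |X (T, ω)| * |Y (T, ω)| ≤ (|C| + 1) * |Y (T, ω)| := by
        gcongr; exact hcon.1.trans ((le_abs_self C).trans (by linarith))
    _ < (|C| + 1) * (δ / (|C| + 1)) := by gcongr; exact hcon.2
    _ = δ := by field_simp

theorem BoundedInProb.add {X Y : ℕ × Ω → ℝ} (hX : BoundedInProb P X) (hY : BoundedInProb P Y) :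
    BoundedInProb P (fun q ↦ X q + Y q) := by
  intro ε hε
  obtain ⟨C, hC⟩ := hX (ε / 2) (ENNReal.half_pos hε.ne')
  obtain ⟨D, hD⟩ := hY (ε / 2) (ENNReal.half_pos hε.ne')
  refine ⟨C + D, ?_⟩
  filter_upwards [hC, hD] with T h1 h2
  refine (measure_mono (t := {ω | C < |X (T, ω)|} ∪ {ω | D < |Y (T, ω)|}) fun ω hω ↦ ?_).trans
    ((measure_union_le _ _).trans ((add_le_add h1 h2).trans (ENNReal.add_halves _).le))
  simp only [Set.mem_union, Set.mem_ofPred_eq] at hω ⊢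
  by_contra! hcon
  linarith [abs_add_le (X (T, ω)) (Y (T, ω))]

theorem IsBigOP.boundedInProb {Z : ℕ → Ω → ℝ≥0∞} (h : IsBigOP P Z) :
    BoundedInProb P (fun q ↦ (Z q.1 q.2).toReal) := by
  intro ε hε
  obtain ⟨C, hC⟩ := h ε hε
  refine ⟨C, ?_⟩
  filter_upwards [hC] with T hT
  refine (measure_mono fun ω hω ↦ ?_).trans hT
  simp only [Set.mem_ofPred_eq, abs_of_nonneg ENNReal.toReal_nonneg] at hω ⊢
  by_contra! hcon
  exact absurd (ENNReal.toReal_mono ENNReal.coe_ne_top hcon) (not_le.2 hω)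

theorem IsBigOP.ne_top {Z : ℕ → Ω → ℝ≥0∞} (h : IsBigOP P Z) :
    ∀ᶠ q in whp P, Z q.1 q.2 ≠ ∞ := by
  rw [eventually_whp_iff, ENNReal.tendsto_nhds_zero]
  intro ε hε
  obtain ⟨C, hC⟩ := h ε hε
  filter_upwards [hC] with T hT
  refine (measure_mono fun ω hω ↦ ?_).trans hT
  simp only [not_not, Set.mem_ofPred_eq] at hω ⊢
  simp [hω]

/-- If a random variable `Y` does not depend on `T` and bounds copies of all `X_T`, then
`X_T = O_P(1)`. -/
theorem boundedInProb_of_identDistrib {Ω' : Type*} [MeasurableSpace Ω'] {P' : Measure Ω'}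
    [IsFiniteMeasure P'] {X : ℕ × Ω → ℝ} {Y : Ω' → ℝ} (hY : AEMeasurable Y P')
    (X' : ℕ → Ω' → ℝ) (hid : ∀ᶠ T in atTop, IdentDistrib (fun ω ↦ X (T, ω)) (X' T) P P')
    (hle : ∀ᶠ T in atTop, ∀ᵐ ω ∂P', |X' T ω| ≤ Y ω) : BoundedInProb P X := by
  intro ε hε
  have hanti : Antitone fun n : ℕ ↦ {ω | (n : ℝ) < Y ω} :=
    fun m n hmn ω (hω : (n : ℝ) < Y ω) ↦ (Nat.cast_le.2 hmn).trans_lt hω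
  have hlim := tendsto_measure_iInter_atTop (μ := P')
    (fun n : ℕ ↦ nullMeasurableSet_lt (aemeasurable_const (b := (n : ℝ))) hY) hanti
    ⟨0, measure_ne_top _ _⟩
  have hempty : (⋂ n : ℕ, {ω | (n : ℝ) < Y ω}) = ∅ := by
    ext ω
    simp only [Set.mem_iInter, Set.mem_ofPred_eq, Set.mem_empty_iff_false, iff_false, not_forall,
      not_lt]
    exact exists_nat_ge _
  rw [hempty, measure_empty] at hlim
  obtain ⟨n, hn⟩ := (ENNReal.tendsto_nhds_zero.1 hlim ε hε).exists
  refine ⟨n, ?_⟩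
  filter_upwards [hid, hle] with T h1 h2
  have h3 : P {ω | (n : ℝ) < |X (T, ω)|} = P' {ω | (n : ℝ) < |X' T ω|} :=
    h1.measure_mem_eq (s := {z : ℝ | (n : ℝ) < |z|})
      (measurableSet_lt measurable_const measurable_norm)
  rw [h3]
  refine (measure_mono_ae ?_).trans hn
  filter_upwards [h2] with ω hω (hlt : (n : ℝ) < |X' T ω|)
  exact hlt.trans_le hω

end Whp

section MaxAbs

variable {ι : Type*}

/-- The maximum of `|f i|` over `i ∈ s`, equal to `0` if `s` is empty. -/
noncomputable def maxAbs (s : Finset ι) (f : ι → ℝ) : ℝ := (s.sup fun i ↦ ‖f i‖₊ : ℝ≥0)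

theorem maxAbs_nonneg (s : Finset ι) (f : ι → ℝ) : 0 ≤ maxAbs s f := NNReal.coe_nonneg _

theorem maxAbs_le_iff {s : Finset ι} {f : ι → ℝ} {c : ℝ} (hc : 0 ≤ c) :
    maxAbs s f ≤ c ↔ ∀ i ∈ s, |f i| ≤ c := by
  lift c to ℝ≥0 using hc
  simp only [maxAbs, NNReal.coe_le_coe, Finset.sup_le_iff]
  rfl

theorem abs_le_maxAbs {s : Finset ι} (f : ι → ℝ) {i : ι} (hi : i ∈ s) : |f i| ≤ maxAbs s f :=
  (maxAbs_le_iff (maxAbs_nonneg s f)).1 le_rfl i hi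

theorem abs_maxAbs (s : Finset ι) (f : ι → ℝ) : |maxAbs s f| = maxAbs s f :=
  abs_of_nonneg (maxAbs_nonneg s f)

theorem maxAbs_le_add {s : Finset ι} {f g : ι → ℝ} {ε : ℝ} (hε : 0 ≤ ε)
    (h : ∀ i ∈ s, |f i| ≤ |g i| + ε) : maxAbs s f ≤ maxAbs s g + ε :=
  (maxAbs_le_iff (add_nonneg (maxAbs_nonneg s g) hε)).2 fun i hi ↦
    (h i hi).trans (add_le_add (abs_le_maxAbs g hi) le_rfl)

theorem abs_maxAbs_sub_le {s : Finset ι} {f g : ι → ℝ} {ε : ℝ} (hε : 0 ≤ ε)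
    (h : ∀ i ∈ s, |f i - g i| ≤ ε) : |maxAbs s f - maxAbs s g| ≤ ε := by
  rw [abs_sub_le_iff]
  constructor
  · linarith [maxAbs_le_add hε fun i hi ↦
      (by linarith [abs_sub_abs_le_abs_sub (f i) (g i), h i hi] : |f i| ≤ |g i| + ε)]
  · linarith [maxAbs_le_add hε fun i hi ↦
      (by linarith [abs_sub_abs_le_abs_sub (g i) (f i), abs_sub_comm (f i) (g i), h i hi] :
        |g i| ≤ |f i| + ε)]

theorem maxAbs_union [DecidableEq ι] (s t : Finset ι) (f : ι → ℝ) :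
    maxAbs (s ∪ t) f = max (maxAbs s f) (maxAbs t f) := by
  simp [maxAbs, Finset.sup_union]

theorem maxAbs_image [DecidableEq ι] {κ : Type*} (s : Finset κ) (e : κ → ι) (f : ι → ℝ) :
    maxAbs (s.image e) f = maxAbs s (f ∘ e) := by
  simp only [maxAbs, Finset.sup_image]
  rfl

theorem maxAbs_congr {s : Finset ι} {f g : ι → ℝ} (h : ∀ i ∈ s, |f i| = |g i|) :
    maxAbs s f = maxAbs s g :=
  le_antisymm ((maxAbs_le_iff (maxAbs_nonneg _ _)).2 fun i hi ↦ h i hi ▸ abs_le_maxAbs g hi)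
    ((maxAbs_le_iff (maxAbs_nonneg _ _)).2 fun i hi ↦ h i hi ▸ abs_le_maxAbs f hi)

theorem maxAbs_const_mul (s : Finset ι) (c : ℝ) (f : ι → ℝ) :
    maxAbs s (fun i ↦ c * f i) = |c| * maxAbs s f := by
  have : (fun i ↦ ‖c * f i‖₊) = fun i ↦ ‖c‖₊ * ‖f i‖₊ := by ext; simp
  simp only [maxAbs, this, ← NNReal.mul_finset_sup]
  simp

theorem measurable_maxAbs {α : Type*} [MeasurableSpace α] (s : Finset ι) {f : ι → α → ℝ}
    (hf : ∀ i ∈ s, Measurable (f i)) : Measurable fun a ↦ maxAbs s (f · a) := by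
  refine measurable_coe_nnreal_real.comp ?_
  classical
  induction s using Finset.induction_on with
  | empty => simp
  | insert i s _ ih =>
    simp only [Finset.sup_insert]
    exact (hf i (by simp)).nnnorm.sup (ih fun j hj ↦ hf j (by simp [hj]))

theorem aemeasurable_maxAbs {α : Type*} [MeasurableSpace α] {μ : Measure α} (s : Finset ι)
    {f : ι → α → ℝ} (hf : ∀ i ∈ s, AEMeasurable (f i) μ) :
    AEMeasurable (fun a ↦ maxAbs s (f · a)) μ := by
  refine measurable_coe_nnreal_real.comp_aemeasurable ?_
  classical
  induction s using Finset.induction_on with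
  | empty => simp
  | insert i s _ ih =>
    simp only [Finset.sup_insert]
    exact (hf i (by simp)).nnnorm.sup (ih fun j hj ↦ hf j (by simp [hj]))

end MaxAbs

section Ergodic

variable {Y : Type*} [MeasurableSpace Y] {μ : Measure Y} {S : Y → Y}

/-- The mean ergodic theorem in `L²`. -/
theorem tendsto_eLpNorm_two_birkhoffAverage [IsProbabilityMeasure μ] (hS : Ergodic S μ)
    {F : Y → ℝ} (hF : MemLp F 2 μ) :
    Tendsto (fun N ↦ eLpNorm (birkhoffAverage ℝ S F N - fun _ ↦ ∫ y, F y ∂μ) 2 μ) atTop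
      (𝓝 0) := by
  have hmp := hS.toMeasurePreserving
  set U : Lp ℝ 2 μ →L[ℝ] Lp ℝ 2 μ :=
    (Lp.compMeasurePreservingₗᵢ ℝ S hmp).toContinuousLinearMap with hU
  have hU1 : ‖U‖ ≤ 1 := LinearIsometry.norm_toContinuousLinearMap_le _
  have hUapp (v : Lp ℝ 2 μ) : U v = Lp.compMeasurePreserving S hmp v := rfl
  set φ : Lp ℝ 2 μ := hF.toLp F
  have hlim := U.tendsto_birkhoffAverage_orthogonalProjection hU1 φ
  set ψ' := (U.eqLocus (1 : Lp ℝ 2 μ →L[ℝ] Lp ℝ 2 μ)).orthogonalProjectionOnto φ with hψ'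
  set ψ : Lp ℝ 2 μ := ψ'.1 with hψ
  have hfix : U ψ = ψ := ψ'.2
  obtain ⟨c, hc⟩ : ∃ c, ψ =ᵐ[μ] Function.const Y c := by
    refine hS.ae_eq_const_of_ae_eq_comp_ae (Lp.aestronglyMeasurable ψ) ?_
    have h := Lp.coeFn_compMeasurePreserving ψ hmp
    rw [← hUapp, hfix] at h
    exact h.symm
  have hiter (n : ℕ) : U^[n] φ =ᵐ[μ] F ∘ S^[n] := by
    induction n with
    | zero => exact hF.coeFn_toLp
    | succ n ih =>
      rw [Function.iterate_succ_apply', hUapp, Function.iterate_succ]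
      exact (Lp.coeFn_compMeasurePreserving _ hmp).trans
        (hmp.quasiMeasurePreserving.ae_eq_comp ih)
  have havg (N : ℕ) : ⇑(birkhoffAverage ℝ U (id : Lp ℝ 2 μ → Lp ℝ 2 μ) N φ) =ᵐ[μ]
      birkhoffAverage ℝ S F N := by
    have hsum : ⇑(∑ n ∈ Finset.range N, U^[n] φ) =ᵐ[μ]
        fun y ↦ ∑ n ∈ Finset.range N, F (S^[n] y) := by
      refine (Lp.coeFn_finsetSum _ _).trans ?_
      have := (Finset.range N).eventually_all (l := ae μ)
        (p := fun n y ↦ (U^[n] φ) y = F (S^[n] y)) |>.2 fun n _ ↦ hiter n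
      filter_upwards [this] with y hy
      simp only [Finset.sum_apply]
      exact Finset.sum_congr rfl hy
    have h1 : birkhoffAverage ℝ U (id : Lp ℝ 2 μ → Lp ℝ 2 μ) N φ =
        (N : ℝ)⁻¹ • ∑ n ∈ Finset.range N, U^[n] φ := rfl
    rw [h1]
    filter_upwards [Lp.coeFn_smul ((N : ℝ)⁻¹) (∑ n ∈ Finset.range N, U^[n] φ), hsum] with y hy hs
    rw [hy, Pi.smul_apply, hs]
    rfl
  have hcF : c = ∫ y, F y ∂μ := by
    set one : Lp ℝ 2 μ := indicatorConstLp 2 MeasurableSet.univ (measure_ne_top μ _) (1 : ℝ)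
    have hone : one ∈ U.eqLocus (1 : Lp ℝ 2 μ →L[ℝ] Lp ℝ 2 μ) := by
      change U one = one
      rw [hUapp]
      exact Lp.indicatorConstLp_compMeasurePreserving MeasurableSet.univ (measure_ne_top μ _) _ hmp
    have horth : inner ℝ one φ = inner ℝ one ψ := by
      have := Submodule.inner_orthogonalProjectionOnto_eq_of_mem_left ⟨one, hone⟩ φ
      exact this.symm
    rw [L2.inner_indicatorConstLp_one, L2.inner_indicatorConstLp_one, setIntegral_univ,
      setIntegral_univ, integral_congr_ae hc, integral_congr_ae hF.coeFn_toLp] at horth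
    simpa using horth.symm
  have h2 : Tendsto (fun N ↦ birkhoffAverage ℝ U (id : Lp ℝ 2 μ → Lp ℝ 2 μ) N φ) atTop (𝓝 ψ) := hlim
  rw [Lp.tendsto_Lp_iff_tendsto_eLpNorm'] at h2
  refine h2.congr fun N ↦ eLpNorm_congr_ae ?_
  filter_upwards [havg N, hc] with y h3 h4
  simp [h3, h4, hcF]

theorem eLpNorm_one_birkhoffAverage_le (hS : MeasurePreserving S μ μ) {F : Y → ℝ}
    (hF : AEStronglyMeasurable F μ) (N : ℕ) :
    eLpNorm (birkhoffAverage ℝ S F N) 1 μ ≤ eLpNorm F 1 μ := by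
  have h1 : birkhoffAverage ℝ S F N = (N : ℝ)⁻¹ • ∑ n ∈ Finset.range N, F ∘ S^[n] := by
    ext y; simp [birkhoffAverage, birkhoffSum]
  have h2 : eLpNorm (∑ n ∈ Finset.range N, F ∘ S^[n]) 1 μ ≤ N * eLpNorm F 1 μ := by
    refine (eLpNorm_sum_le (fun n _ ↦ hF.comp_measurePreserving (hS.iterate n)) le_rfl).trans ?_
    simp [eLpNorm_comp_measurePreserving hF (hS.iterate _)]
  rw [h1, eLpNorm_const_smul]
  rcases N.eq_zero_or_pos with rfl | hN
  · simp
  calc _ ≤ ‖(N : ℝ)⁻¹‖ₑ * (N * eLpNorm F 1 μ) := by gcongr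
    _ = eLpNorm F 1 μ := by
      rw [← mul_assoc, enorm_inv (by positivity), Real.enorm_natCast,
        ENNReal.inv_mul_cancel (by positivity) (by simp), one_mul]

/-- The mean ergodic theorem in `L¹`. -/
theorem tendsto_eLpNorm_one_birkhoffAverage [IsProbabilityMeasure μ] (hS : Ergodic S μ)
    {F : Y → ℝ} (hF : Integrable F μ) :
    Tendsto (fun N ↦ eLpNorm (birkhoffAverage ℝ S F N - fun _ ↦ ∫ y, F y ∂μ) 1 μ) atTop
      (𝓝 0) := by
  have hmp := hS.toMeasurePreserving
  rw [ENNReal.tendsto_nhds_zero]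
  intro ε hε
  have hε3 : ε / 3 ≠ 0 := (ENNReal.div_pos hε.ne' (by simp)).ne'
  obtain ⟨G, hG, hG2⟩ : ∃ G : Y → ℝ, eLpNorm (F - G) 1 μ < ε / 3 ∧ MemLp G 2 μ := by
    obtain ⟨G, hG, -⟩ := (memLp_one_iff_integrable.2 hF).exists_simpleFunc_eLpNorm_sub_lt
      ENNReal.one_ne_top hε3
    exact ⟨G, hG, G.memLp_of_isFiniteMeasure 2 μ⟩
  have hGi : Integrable G μ := hG2.integrable (by norm_num)
  have hm (H : Y → ℝ) (hH : AEStronglyMeasurable H μ) (N : ℕ) :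
      AEStronglyMeasurable (birkhoffAverage ℝ S H N) μ := by
    have : birkhoffAverage ℝ S H N = (N : ℝ)⁻¹ • ∑ n ∈ Finset.range N, H ∘ S^[n] := by
      ext y; simp [birkhoffAverage, birkhoffSum]
    rw [this]
    exact (Finset.aestronglyMeasurable_sum _
      fun n _ ↦ hH.comp_measurePreserving (hmp.iterate n)).const_smul _
  filter_upwards [ENNReal.tendsto_nhds_zero.1 (tendsto_eLpNorm_two_birkhoffAverage hS hG2) (ε / 3)
    (pos_iff_ne_zero.2 hε3)] with N hN
  have hdec : (birkhoffAverage ℝ S F N - fun _ ↦ ∫ y, F y ∂μ) =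
      birkhoffAverage ℝ S (F - G) N + ((birkhoffAverage ℝ S G N - fun _ ↦ ∫ y, G y ∂μ) +
        fun _ ↦ ∫ y, (G y - F y) ∂μ) := by
    ext y
    simp only [birkhoffAverage, birkhoffSum, Pi.sub_apply, Pi.add_apply, smul_eq_mul,
      Finset.sum_sub_distrib, mul_sub]
    rw [integral_sub hGi hF]
    ring
  have h3 : eLpNorm (fun _ : Y ↦ ∫ y, (G y - F y) ∂μ) 1 μ ≤ ε / 3 := by
    rw [eLpNorm_const _ one_ne_zero (IsProbabilityMeasure.ne_zero μ)]
    simp only [measure_univ, ENNReal.one_rpow, mul_one]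
    refine (enorm_integral_le_lintegral_enorm _).trans ?_
    rw [← eLpNorm_one_eq_lintegral_enorm]
    refine le_of_eq_of_le ?_ hG.le
    rw [← eLpNorm_neg]
    congr 1
    ext y
    simp
  have h2 : eLpNorm (birkhoffAverage ℝ S G N - fun _ ↦ ∫ y, G y ∂μ) 1 μ ≤ ε / 3 :=
    (eLpNorm_le_eLpNorm_of_exponent_le (by norm_num)
      ((hm G hGi.1 N).sub aestronglyMeasurable_const)).trans hN
  have h1 : eLpNorm (birkhoffAverage ℝ S (F - G) N) 1 μ ≤ ε / 3 :=
    (eLpNorm_one_birkhoffAverage_le hmp (hF.1.sub hGi.1) N).trans hG.le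
  rw [hdec]
  refine (eLpNorm_add_le (hm _ (hF.1.sub hGi.1) N)
    (((hm G hGi.1 N).sub aestronglyMeasurable_const).add aestronglyMeasurable_const) le_rfl).trans
    ?_
  refine (add_le_add h1 ((eLpNorm_add_le ((hm G hGi.1 N).sub aestronglyMeasurable_const)
    aestronglyMeasurable_const le_rfl).trans (add_le_add h2 h3))).trans ?_
  rw [← add_assoc, ENNReal.add_thirds]

theorem tendstoInMeasure_birkhoffAverage [IsProbabilityMeasure μ] (hS : Ergodic S μ)
    {F : Y → ℝ} (hF : Integrable F μ) :
    TendstoInMeasure μ (birkhoffAverage ℝ S F) atTop fun _ ↦ ∫ y, F y ∂μ := by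
  have hmp := hS.toMeasurePreserving
  refine tendstoInMeasure_of_tendsto_eLpNorm one_ne_zero (fun N ↦ ?_) aestronglyMeasurable_const
    (tendsto_eLpNorm_one_birkhoffAverage hS hF)
  have : birkhoffAverage ℝ S F N = (N : ℝ)⁻¹ • ∑ n ∈ Finset.range N, F ∘ S^[n] := by
    ext y; simp [birkhoffAverage, birkhoffSum]
  rw [this]
  exact (Finset.aestronglyMeasurable_sum _
    fun n _ ↦ hF.1.comp_measurePreserving (hmp.iterate n)).const_smul _

/-- The maximal ergodic theorem: the integral of `F` over the set where some Birkhoff sum is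
positive is nonnegative. -/
theorem setIntegral_nonneg_of_birkhoffSum_pos (hS : MeasurePreserving S μ μ) {F : Y → ℝ}
    (hFm : Measurable F) (hF : Integrable F μ) (N : ℕ) :
    0 ≤ ∫ y in {y | ∃ n ∈ Finset.Icc 1 N, 0 < birkhoffSum S F n y}, F y ∂μ := by
  set A := {y | ∃ n ∈ Finset.Icc 1 N, 0 < birkhoffSum S F n y} with hA
  set M : Y → ℝ := fun y ↦ (Finset.range (N + 1)).sup' ⟨0, by simp⟩
    (fun n ↦ birkhoffSum S F n y) with hM
  have hsm (n : ℕ) : Measurable (birkhoffSum S F n) := by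
    unfold birkhoffSum
    exact Finset.measurable_sum _ fun k _ ↦ hFm.comp (hS.iterate k).measurable
  have hsi (n : ℕ) : Integrable (birkhoffSum S F n) μ := by
    unfold birkhoffSum
    exact integrable_finsetSum _ fun k _ ↦ (hS.iterate k).integrable_comp_of_integrable hF
  have hMi : Integrable M μ := by
    refine Integrable.mono' (integrable_finsetSum (Finset.range (N + 1)) fun n _ ↦ (hsi n).abs)
      (Measurable.aestronglyMeasurable ?_) (ae_of_all _ fun y ↦ ?_)
    · exact Finset.measurable_range_sup'' fun n _ ↦ hsm n
    · rw [Real.norm_eq_abs, abs_le]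
      constructor
      · refine le_trans ?_ (Finset.le_sup' (fun n ↦ birkhoffSum S F n y)
          (Finset.mem_range.2 N.succ_pos))
        simp only [birkhoffSum_zero, Left.neg_nonpos_iff]
        exact Finset.sum_nonneg fun _ _ ↦ abs_nonneg _
      · refine Finset.sup'_le _ _ fun n hn ↦ (le_abs_self _).trans ?_
        exact Finset.single_le_sum (f := fun n ↦ |birkhoffSum S F n y|)
          (fun _ _ ↦ abs_nonneg _) hn
  have hM0 (y : Y) : 0 ≤ M y := by
    simpa using Finset.le_sup' (fun n ↦ birkhoffSum S F n y) (Finset.mem_range.2 N.succ_pos)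
  have hAm : MeasurableSet A := by
    have : A = ⋃ n ∈ Finset.Icc 1 N, {y | 0 < birkhoffSum S F n y} := by ext; simp [hA]
    rw [this]
    exact Finset.measurableSet_biUnion _ fun n _ ↦ measurableSet_lt measurable_const (hsm n)
  have hMA (y : Y) (hy : y ∉ A) : M y = 0 := by
    refine le_antisymm (Finset.sup'_le _ _ fun n hn ↦ ?_) (hM0 y)
    rcases n.eq_zero_or_pos with rfl | hn0
    · simp
    · by_contra! hcon
      exact hy ⟨n, Finset.mem_Icc.2 ⟨hn0, Nat.lt_succ_iff.1 (Finset.mem_range.1 hn)⟩, hcon⟩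
  have hkey (y : Y) (hy : y ∈ A) : M y - M (S y) ≤ F y := by
    obtain ⟨k, hk, hkpos⟩ := hy
    rw [Finset.mem_Icc] at hk
    have hstep (n : ℕ) (h1 : 1 ≤ n) (hn : n ≤ N) : birkhoffSum S F n y ≤ F y + M (S y) := by
      obtain ⟨m, rfl⟩ := Nat.exists_eq_add_of_le' h1
      rw [birkhoffSum_succ']
      gcongr
      exact Finset.le_sup' (fun n ↦ birkhoffSum S F n (S y)) (Finset.mem_range.2 (by omega))
    rw [sub_le_iff_le_add]
    refine Finset.sup'_le _ _ fun n hn ↦ ?_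
    rcases n.eq_zero_or_pos with rfl | hn0
    · rw [birkhoffSum_zero]
      exact hkpos.le.trans (hstep k hk.1 hk.2)
    · exact hstep n hn0 (Nat.lt_succ_iff.1 (Finset.mem_range.1 hn))
  have hMSi : Integrable (fun y ↦ M (S y)) μ := hS.integrable_comp_of_integrable hMi
  calc 0 = ∫ y, M y ∂μ - ∫ y, M (S y) ∂μ := by
        have h := integral_map hS.measurable.aemeasurable (f := M) (by rw [hS.map_eq]; exact hMi.1)
        rw [hS.map_eq] at h
        rw [h, sub_self]
    _ ≤ ∫ y in A, M y ∂μ - ∫ y in A, M (S y) ∂μ := by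
        rw [setIntegral_eq_integral_of_forall_compl_eq_zero fun y hy ↦ hMA y hy]
        gcongr
        exact ae_of_all _ fun y ↦ hM0 _
        · exact Measure.restrict_le_self
    _ = ∫ y in A, (M y - M (S y)) ∂μ := (integral_sub hMi.integrableOn hMSi.integrableOn).symm
    _ ≤ ∫ y in A, F y ∂μ :=
        setIntegral_mono_on (hMi.sub hMSi).integrableOn hF.integrableOn hAm hkey

/-- The weak-type maximal inequality for Birkhoff averages. -/
theorem mul_measure_birkhoffSum_gt_le [IsProbabilityMeasure μ] (hS : MeasurePreserving S μ μ)
    {F : Y → ℝ} (hFm : Measurable F) (hF : Integrable F μ) {C : ℝ} (hC : 0 ≤ C) (N : ℕ) :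
    ENNReal.ofReal C * μ {y | ∃ n ∈ Finset.Icc 1 N, C * n < birkhoffSum S F n y} ≤
      ENNReal.ofReal (∫ y, |F y| ∂μ) := by
  have h := setIntegral_nonneg_of_birkhoffSum_pos hS (hFm.sub_const C)
    (hF.sub (integrable_const C)) N
  have hset : {y | ∃ n ∈ Finset.Icc 1 N, 0 < birkhoffSum S (fun y ↦ F y - C) n y} =
      {y | ∃ n ∈ Finset.Icc 1 N, C * n < birkhoffSum S F n y} := by
    ext y
    simp [birkhoffSum, mul_comm]
  rw [hset, integral_sub hF.integrableOn (integrable_const C)] at h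
  simp only [integral_const, smul_eq_mul, measureReal_restrict_apply_univ] at h
  have h2 : ∫ y in {y | ∃ n ∈ Finset.Icc 1 N, C * n < birkhoffSum S F n y}, F y ∂μ ≤
      ∫ y, |F y| ∂μ :=
    (setIntegral_mono hF.integrableOn hF.abs.integrableOn fun y ↦ le_abs_self _).trans
      (setIntegral_le_integral hF.abs (ae_of_all _ fun _ ↦ abs_nonneg _))
  rw [← ENNReal.ofReal_toReal (measure_ne_top μ _), ← ENNReal.ofReal_mul hC]
  refine ENNReal.ofReal_le_ofReal ?_
  simp only [measureReal_def] at h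
  linarith

end Ergodic

section Stationary

variable {Ω E : Type*} [MeasurableSpace Ω] [MeasurableSpace E] {P : Measure Ω}

/-- The shift on the space of two-sided sequences. -/
def shift (E : Type*) [MeasurableSpace E] : (ℤ → E) ≃ᵐ (ℤ → E) where
  toFun y t := y (t + 1)
  invFun y t := y (t - 1)
  left_inv y := by ext t; simp
  right_inv y := by ext t; simp
  measurable_toFun := by
    simp only [Equiv.coe_fn_mk]; fun_prop
  measurable_invFun := by
    simp only [Equiv.coe_fn_symm_mk]; fun_prop

theorem shift_iterate (n : ℕ) (y : ℤ → E) (t : ℤ) : (shift E)^[n] y t = y (t + n) := by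
  induction n generalizing y with
  | zero => simp
  | succ n ih =>
    rw [Function.iterate_succ_apply, ih]
    change y (t + n + 1) = _
    congr 1
    push_cast
    ring

theorem shift_symm_iterate (n : ℕ) (y : ℤ → E) (t : ℤ) :
    (shift E).symm^[n] y t = y (t - n) := by
  induction n generalizing y with
  | zero => simp
  | succ n ih =>
    rw [Function.iterate_succ_apply, ih]
    change y (t - n - 1) = _
    congr 1
    push_cast
    ring

theorem sum_Icc_eq_birkhoffSum (f : E → ℝ) (T : ℕ) (y : ℤ → E) :
    ∑ s ∈ Finset.Icc 1 T, f (y (s : ℤ)) = birkhoffSum (shift E) (fun y ↦ f (y 1)) T y := by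
  simp only [birkhoffSum, shift_iterate]
  refine (Finset.sum_bij (fun k _ ↦ k + 1) (fun k hk ↦ ?_) (fun _ _ _ _ ↦ by simp)
    (fun k hk ↦ ⟨k - 1, ?_⟩) fun k _ ↦ ?_).symm
  · simp only [Finset.mem_range, Finset.mem_Icc] at hk ⊢; omega
  · simp only [Finset.mem_range, Finset.mem_Icc] at hk ⊢
    exact ⟨by omega, by omega⟩
  · push_cast; rw [add_comm]

theorem sum_Icc_eq_birkhoffSum_symm (f : E → ℝ) {t T : ℕ} (htT : t ≤ T) (y : ℤ → E) :
    ∑ s ∈ Finset.Icc (t + 1) T, f (y (s : ℤ)) =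
      birkhoffSum (shift E).symm (fun y ↦ f (y 0)) (T - t) ((shift E)^[T] y) := by
  simp only [birkhoffSum, shift_iterate, shift_symm_iterate]
  refine (Finset.sum_bij (fun k _ ↦ T - k) (fun k hk ↦ ?_) (fun a ha b hb ↦ ?_)
    (fun k hk ↦ ⟨T - k, ?_⟩) fun k hk ↦ ?_).symm
  · simp only [Finset.mem_range, Finset.mem_Icc] at hk ⊢; omega
  · simp only [Finset.mem_range] at ha hb ⊢; omega
  · simp only [Finset.mem_range, Finset.mem_Icc] at hk ⊢
    exact ⟨by omega, by omega⟩
  · simp only [Finset.mem_range] at hk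
    rw [Nat.cast_sub (by omega)]
    congr 2
    ring

theorem exists_pos_forall_le_of_mul_le (I : ℝ) {ε : ℝ≥0∞} (hε : 0 < ε) :
    ∃ C : ℝ, 0 < C ∧ ∀ a : ℝ≥0∞, ENNReal.ofReal C * a ≤ ENNReal.ofReal I → a ≤ ε := by
  refine ⟨(ENNReal.ofReal I / ε).toReal + 1, by positivity, fun a ha ↦ ?_⟩
  have hne : ENNReal.ofReal I / ε ≠ ∞ := ENNReal.div_ne_top ENNReal.ofReal_ne_top hε.ne'
  set D := ENNReal.ofReal ((ENNReal.ofReal I / ε).toReal + 1) with hD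
  have hD0 : D ≠ 0 := by simp only [hD, ne_eq, ENNReal.ofReal_eq_zero, not_le]; positivity
  have h1 : ENNReal.ofReal I ≤ D * ε := by
    rw [← ENNReal.div_le_iff_le_mul (Or.inl hε.ne') (Or.inr hD0)]
    rw [hD, ENNReal.ofReal_add ENNReal.toReal_nonneg zero_le_one, ENNReal.ofReal_toReal hne]
    exact le_self_add
  exact (ENNReal.mul_le_mul_iff_right hD0 ENNReal.ofReal_ne_top).1 (ha.trans h1)

/-- A sequence of random variables which is stationary and ergodic. -/
structure IsStationaryErgodic (P : Measure Ω) (x : ℤ → Ω → E) : Prop where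
  measurable : ∀ t, Measurable (x t)
  ergodic : Ergodic (shift E) (P.map fun ω t ↦ x t ω)

namespace IsStationaryErgodic

variable {x : ℤ → Ω → E}

theorem measurable_path (h : IsStationaryErgodic P x) : Measurable fun ω t ↦ x t ω :=
  measurable_pi_lambda _ h.measurable

theorem measurePreserving_eval (h : IsStationaryErgodic P x) (t s : ℤ) :
    (P.map fun ω t ↦ x t ω).map (fun y ↦ y t) = (P.map fun ω t ↦ x t ω).map (fun y ↦ y s) := by
  have key (t : ℤ) (n : ℕ) : (P.map fun ω t ↦ x t ω).map (fun y ↦ y (t + n)) =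
      (P.map fun ω t ↦ x t ω).map (fun y ↦ y t) := by
    have hmp := h.ergodic.toMeasurePreserving.iterate n
    have := Measure.map_map (μ := P.map fun ω t ↦ x t ω) (measurable_pi_apply t) hmp.measurable
    rw [hmp.map_eq] at this
    rw [this]
    congr 1
    ext y
    exact (shift_iterate n y t).symm
  rcases le_total t s with hts | hst
  · obtain ⟨n, rfl⟩ := Int.le.dest hts
    exact (key t n).symm
  · obtain ⟨n, rfl⟩ := Int.le.dest hst
    exact key s n

theorem identDistrib (h : IsStationaryErgodic P x) (t s : ℤ) :
    IdentDistrib (x t) (x s) P P where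
  aemeasurable_fst := (h.measurable t).aemeasurable
  aemeasurable_snd := (h.measurable s).aemeasurable
  map_eq := by
    have := h.measurePreserving_eval t s
    rwa [Measure.map_map (measurable_pi_apply t) h.measurable_path,
      Measure.map_map (measurable_pi_apply s) h.measurable_path] at this

theorem integrable_eval (h : IsStationaryErgodic P x) {f : E → ℝ} (hf : Measurable f)
    (hi : Integrable (fun ω ↦ f (x 0 ω)) P) (t : ℤ) :
    Integrable (fun y : ℤ → E ↦ f (y t)) (P.map fun ω t ↦ x t ω) := by
  refine (integrable_map_measure (hf.comp (measurable_pi_apply t)).aestronglyMeasurable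
    h.measurable_path.aemeasurable).2 ?_
  exact ((h.identDistrib t 0).comp hf).integrable_iff.2 hi

variable [IsProbabilityMeasure P]

/-- The law of large numbers (in probability) for a stationary ergodic sequence. -/
theorem tendsto_average (h : IsStationaryErgodic P x) {f : E → ℝ} (hf : Measurable f)
    (hi : Integrable (fun ω ↦ f (x 0 ω)) P) :
    Tendsto (fun q : ℕ × Ω ↦ (1 / (q.1 : ℝ)) * ∑ s ∈ Finset.Icc 1 q.1, f (x (s : ℤ) q.2)) (whp P)
      (𝓝 (∫ ω, f (x 0 ω) ∂P)) := by
  have : IsProbabilityMeasure (P.map fun ω t ↦ x t ω) :=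
    Measure.isProbabilityMeasure_map h.measurable_path.aemeasurable
  have hi1 := h.integrable_eval hf hi 1
  have hlim := tendstoInMeasure_birkhoffAverage h.ergodic hi1
  have hmean : ∫ y : ℤ → E, f (y 1) ∂(P.map fun ω t ↦ x t ω) = ∫ ω, f (x 0 ω) ∂P := by
    rw [integral_map h.measurable_path.aemeasurable hi1.1]
    exact ((h.identDistrib 1 0).comp hf).integral_eq
  rw [hmean] at hlim
  refine tendsto_whp_of_tendstoInMeasure
    (X := fun T ω ↦ (1 / (T : ℝ)) * ∑ s ∈ Finset.Icc 1 T, f (x (s : ℤ) ω)) fun ε hε ↦ ?_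
  refine tendsto_of_tendsto_of_tendsto_of_le_of_le tendsto_const_nhds (hlim ε hε)
    (fun _ ↦ zero_le) fun T ↦ ?_
  refine le_trans (le_of_eq ?_) (Measure.le_map_apply h.measurable_path.aemeasurable _)
  congr 1
  ext ω
  simp only [Set.mem_ofPred_eq, Set.mem_preimage, birkhoffAverage, smul_eq_mul, one_div]
  rw [sum_Icc_eq_birkhoffSum f T fun s ↦ x s ω]

/-- The maximum over `t ≤ T` of averages over `1, …, t` is bounded in probability. -/
theorem boundedInProb_maxAbs_average_fst (h : IsStationaryErgodic P x) {f : E → ℝ}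
    (hf : Measurable f) (hf0 : ∀ y, 0 ≤ f y) (hi : Integrable (fun ω ↦ f (x 0 ω)) P) :
    BoundedInProb P fun q ↦ maxAbs (Finset.Icc 1 q.1)
      fun t : ℕ ↦ (1 / (t : ℝ)) * ∑ s ∈ Finset.Icc 1 t, f (x (s : ℤ) q.2) := by
  have : IsProbabilityMeasure (P.map fun ω t ↦ x t ω) :=
    Measure.isProbabilityMeasure_map h.measurable_path.aemeasurable
  intro ε hε
  obtain ⟨C, hC, hCε⟩ := exists_pos_forall_le_of_mul_le
    (∫ y : ℤ → E, |f (y 1)| ∂(P.map fun ω t ↦ x t ω)) hε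
  refine ⟨C, Eventually.of_forall fun T ↦ ?_⟩
  have hmax := hCε _ (mul_measure_birkhoffSum_gt_le h.ergodic.toMeasurePreserving
    (hf.comp (measurable_pi_apply 1)) (h.integrable_eval hf hi 1) hC.le T)
  refine le_trans ?_ ((Measure.le_map_apply h.measurable_path.aemeasurable _).trans hmax)
  refine measure_mono fun ω hω ↦ ?_
  simp only [abs_maxAbs, Set.mem_ofPred_eq] at hω
  rw [← not_le, maxAbs_le_iff hC.le] at hω
  push Not at hω
  obtain ⟨t, ht, hlt⟩ := hω
  have ht0 : (0 : ℝ) < t := by exact_mod_cast (Finset.mem_Icc.1 ht).1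
  refine ⟨t, ht, ?_⟩
  have hsum := sum_Icc_eq_birkhoffSum f t fun s ↦ x s ω
  rw [abs_of_nonneg (mul_nonneg (by positivity) (Finset.sum_nonneg fun _ _ ↦ hf0 _)), hsum,
    one_div, ← div_eq_inv_mul, lt_div_iff₀ ht0] at hlt
  exact hlt

/-- The maximum over `t < T` of averages over `t + 1, …, T` is bounded in probability. -/
theorem boundedInProb_maxAbs_average_snd (h : IsStationaryErgodic P x) {f : E → ℝ}
    (hf : Measurable f) (hf0 : ∀ y, 0 ≤ f y) (hi : Integrable (fun ω ↦ f (x 0 ω)) P) :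
    BoundedInProb P fun q ↦ maxAbs (Finset.range q.1)
      fun t : ℕ ↦ (1 / ((q.1 : ℝ) - t)) * ∑ s ∈ Finset.Icc (t + 1) q.1, f (x (s : ℤ) q.2) := by
  have : IsProbabilityMeasure (P.map fun ω t ↦ x t ω) :=
    Measure.isProbabilityMeasure_map h.measurable_path.aemeasurable
  intro ε hε
  obtain ⟨C, hC, hCε⟩ := exists_pos_forall_le_of_mul_le
    (∫ y : ℤ → E, |f (y 0)| ∂(P.map fun ω t ↦ x t ω)) hε
  refine ⟨C, Eventually.of_forall fun T ↦ ?_⟩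
  have hmax := hCε _ (mul_measure_birkhoffSum_gt_le h.ergodic.symm.toMeasurePreserving
    (hf.comp (measurable_pi_apply 0)) (h.integrable_eval hf hi 0) hC.le T)
  have hT := h.ergodic.toMeasurePreserving.iterate T
  rw [← hT.map_eq] at hmax
  refine le_trans ?_ ((Measure.le_map_apply h.measurable_path.aemeasurable _).trans
    ((Measure.le_map_apply hT.measurable.aemeasurable _).trans hmax))
  refine measure_mono fun ω hω ↦ ?_
  simp only [abs_maxAbs, Set.mem_ofPred_eq] at hω
  rw [← not_le, maxAbs_le_iff hC.le] at hω
  push Not at hω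
  obtain ⟨t, ht, hlt⟩ := hω
  rw [Finset.mem_range] at ht
  have ht0 : (0 : ℝ) < (T : ℝ) - t := sub_pos.2 (by exact_mod_cast ht)
  refine ⟨T - t, Finset.mem_Icc.2 ⟨by omega, by omega⟩, ?_⟩
  have hsum := sum_Icc_eq_birkhoffSum_symm f ht.le fun s ↦ x s ω
  rw [abs_of_nonneg (mul_nonneg (by positivity) (Finset.sum_nonneg fun _ _ ↦ hf0 _)), hsum,
    one_div, ← div_eq_inv_mul, lt_div_iff₀ ht0, ← Nat.cast_sub ht.le] at hlt
  exact hlt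

end IsStationaryErgodic

end Stationary

section Wiener

variable {Ω Ω' : Type*} [MeasurableSpace Ω] [MeasurableSpace Ω'] {P : Measure Ω} {P' : Measure Ω'}

/-- Two Gaussian families with the same means and covariances have the same law. -/
theorem identDistrib_of_hasGaussianLaw {ι : Type*} [Fintype ι] {X : ι → Ω → ℝ} {Y : ι → Ω' → ℝ}
    (hX : HasGaussianLaw (fun ω ↦ (X · ω)) P) (hY : HasGaussianLaw (fun ω ↦ (Y · ω)) P')
    (hm : ∀ i, ∫ ω, X i ω ∂P = ∫ ω, Y i ω ∂P')
    (hc : ∀ i j, cov[X i, X j; P] = cov[Y i, Y j; P']) :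
    IdentDistrib (fun ω ↦ (X · ω)) (fun ω ↦ (Y · ω)) P P' where
  aemeasurable_fst := hX.aemeasurable
  aemeasurable_snd := hY.aemeasurable
  map_eq := by
    have := hX.isProbabilityMeasure
    have := hY.isProbabilityMeasure
    have hXL := hX.toLp_pi 2
    have hYL := hY.toLp_pi 2
    have h1 := hXL.isGaussian_map
    have h2 := hYL.isGaussian_map
    apply (MeasurableEquiv.toLp 2 (ι → ℝ)).map_measurableEquiv_injective
    rw [AEMeasurable.map_map_of_aemeasurable (by fun_prop) hX.aemeasurable,
      AEMeasurable.map_map_of_aemeasurable (by fun_prop) hY.aemeasurable]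
    change P.map (fun ω ↦ WithLp.toLp 2 (X · ω)) = P'.map (fun ω ↦ WithLp.toLp 2 (Y · ω))
    apply IsGaussian.ext
    · rw [integral_map hXL.aemeasurable (by fun_prop), integral_map hYL.aemeasurable (by fun_prop)]
      ext i
      simp only [id_eq]
      rw [eval_integral_piLp fun j ↦ (hX.eval j).integrable,
        eval_integral_piLp fun j ↦ (hY.eval j).integrable]
      exact hm i
    · ext x y
      rw [covarianceBilin_apply_pi fun i ↦ (hX.eval i).memLp_two,
        covarianceBilin_apply_pi fun i ↦ (hY.eval i).memLp_two]
      simp_rw [hc]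

namespace IsWienerOn

variable {S S' : ℝ≥0} {W : ℝ≥0 → Ω → ℝ} {W' : ℝ≥0 → Ω' → ℝ}

theorem hasGaussianLaw (hW : IsWienerOn P S W) {ι : Type*} [Fintype ι] (τ : ι → ℝ≥0)
    (hτ : ∀ i, τ i ≤ S) (c : ι → ℝ) : HasGaussianLaw (fun ω i ↦ c i * W (τ i) ω) P := by
  classical
  set I : Finset ℝ≥0 := Finset.univ.image τ
  have hmem (i : ι) : τ i ∈ I := Finset.mem_image_of_mem _ (Finset.mem_univ i)
  have h := (hW.hasLaw I (by simpa [I] using hτ)).hasGaussianLaw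
  exact h.map_fun (ContinuousLinearMap.pi fun i ↦
    c i • ContinuousLinearMap.proj (R := ℝ) (φ := fun _ : I ↦ ℝ) ⟨τ i, hmem i⟩)

theorem integral_eval (hW : IsWienerOn P S W) {t : ℝ≥0} (ht : t ≤ S) : ∫ ω, W t ω ∂P = 0 := by
  have h := (hW.hasLaw {t} (by simpa using ht)).integral_comp
    (f := fun x ↦ x ⟨t, by simp⟩) (Measurable.aestronglyMeasurable (by fun_prop))
  rw [BrownianReal.integral_eval_projectiveFamily] at h
  exact h

theorem covariance_eval (hW : IsWienerOn P S W) {s t : ℝ≥0} (hs : s ≤ S) (ht : t ≤ S) :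
    cov[W s, W t; P] = min s t := by
  have h := (hW.hasLaw {s, t} (by simp [hs, ht])).covariance_fun_comp
    (f := fun x ↦ x ⟨s, by simp⟩) (g := fun x ↦ x ⟨t, by simp⟩)
    (Measurable.aemeasurable (by fun_prop)) (Measurable.aemeasurable (by fun_prop))
  rw [BrownianReal.covariance_eval_projectiveFamily] at h
  exact h

/-- Rescalings of Wiener processes along finitely many times have the same law as soon as their
covariances agree. -/
theorem identDistrib_mul (hW : IsWienerOn P S W) (hW' : IsWienerOn P' S' W') {ι : Type*}
    [Fintype ι] {τ u : ι → ℝ≥0} (hτ : ∀ i, τ i ≤ S) (hu : ∀ i, u i ≤ S') {c : ι → ℝ}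
    (h : ∀ i j, c i * c j * min (τ i) (τ j) = min (u i) (u j)) :
    IdentDistrib (fun ω i ↦ c i * W (τ i) ω) (fun ω i ↦ W' (u i) ω) P P' := by
  have hY := hW'.hasGaussianLaw u hu 1
  simp only [Pi.one_apply, one_mul] at hY
  refine identDistrib_of_hasGaussianLaw (X := fun i ω ↦ c i * W (τ i) ω)
    (Y := fun i ω ↦ W' (u i) ω) (hW.hasGaussianLaw τ hτ c) hY
    (fun i ↦ ?_) fun i j ↦ ?_
  · rw [integral_const_mul, hW.integral_eval (hτ i), hW'.integral_eval (hu i), mul_zero]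
  · rw [covariance_const_mul_left, covariance_const_mul_right]
    change c i * (c j * cov[W (τ i), W (τ j); P]) = cov[W' (u i), W' (u j); P']
    rw [hW.covariance_eval (hτ i) (hτ j), hW'.covariance_eval (hu i) (hu j), ← h, mul_assoc]

theorem identDistrib_maxAbs (hW : IsWienerOn P S W) (hW' : IsWienerOn P' S' W') {ι : Type*}
    (s : Finset ι) {τ u : ι → ℝ≥0} (hτ : ∀ i ∈ s, τ i ≤ S) (hu : ∀ i ∈ s, u i ≤ S') {c : ι → ℝ}
    (h : ∀ i ∈ s, ∀ j ∈ s, c i * c j * min (τ i) (τ j) = min (u i) (u j)) :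
    IdentDistrib (fun ω ↦ maxAbs s fun i ↦ c i * W (τ i) ω)
      (fun ω ↦ maxAbs s fun i ↦ W' (u i) ω) P P' := by
  have key := hW.identDistrib_mul hW' (ι := s) (τ := fun i ↦ τ i) (u := fun i ↦ u i)
    (c := fun i ↦ c i) (fun i ↦ hτ i i.2) (fun i ↦ hu i i.2) fun i j ↦ h i i.2 j j.2
  have hm : Measurable fun z : s → ℝ ↦ maxAbs Finset.univ z :=
    measurable_maxAbs _ fun i _ ↦ measurable_pi_apply i
  have hatt (f : ι → ℝ) : maxAbs s f = maxAbs Finset.univ fun i : s ↦ f i := by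
    simp only [maxAbs, Finset.univ_eq_attach]
    rw [Finset.sup_attach s fun i ↦ ‖f i‖₊]
  simp_rw [hatt]
  exact key.comp hm

end IsWienerOn

/-- The maximum of `|f|` over `[0, 1]`. -/
noncomputable def supAbs (f : ℝ≥0 → ℝ) : ℝ := ⨆ u : Set.Icc (0 : ℝ≥0) 1, |f u|

theorem abs_le_supAbs {f : ℝ≥0 → ℝ} (hf : ContinuousOn f (Set.Icc 0 1)) {u : ℝ≥0} (hu : u ≤ 1) :
    |f u| ≤ supAbs f := by
  have hcomp : IsCompact ((fun u ↦ |f u|) '' Set.Icc (0 : ℝ≥0) 1) :=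
    isCompact_Icc.image_of_continuousOn hf.abs
  refine le_ciSup (f := fun u : Set.Icc (0 : ℝ≥0) 1 ↦ |f u|) ?_ ⟨u, zero_le, hu⟩
  refine hcomp.bddAbove.mono ?_
  rintro _ ⟨v, rfl⟩
  exact ⟨v, v.2, rfl⟩

theorem supAbs_nonneg (f : ℝ≥0 → ℝ) : 0 ≤ supAbs f := Real.iSup_nonneg fun _ ↦ abs_nonneg _

theorem maxAbs_le_supAbs {f : ℝ≥0 → ℝ} (hf : ContinuousOn f (Set.Icc 0 1)) {ι : Type*}
    (s : Finset ι) {u : ι → ℝ≥0} (hu : ∀ i ∈ s, u i ≤ 1) : maxAbs s (fun i ↦ f (u i)) ≤ supAbs f :=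
  (maxAbs_le_iff (supAbs_nonneg f)).2 fun i hi ↦ abs_le_supAbs hf (hu i hi)

/-- Integer times of the first half of the sample which are not trimmed. -/
noncomputable def halfTimes (T : ℕ) (a : ℝ) : Finset ℕ :=
  open scoped Classical in (Finset.Icc 1 (T / 2)).filter fun t ↦ a ≤ t

theorem mem_halfTimes {T : ℕ} {a : ℝ} {t : ℕ} :
    t ∈ halfTimes T a ↔ 1 ≤ t ∧ 2 * t ≤ T ∧ a ≤ t := by
  simp only [halfTimes, Finset.mem_filter, Finset.mem_Icc]
  constructor
  · rintro ⟨⟨h1, h2⟩, h3⟩; exact ⟨h1, by omega, h3⟩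
  · rintro ⟨h1, h2, h3⟩; exact ⟨⟨h1, by omega⟩, h3⟩

/-- The maximum of a continuous function over the points `a_T / t` tends to its maximum over
`[0, 1]`. -/
theorem tendsto_maxAbs_halfTimes {f : ℝ≥0 → ℝ} (hf : ContinuousOn f (Set.Icc 0 1)) {a : ℕ → ℝ}
    (ha : TrimmingCondition a) :
    Tendsto (fun T ↦ maxAbs (halfTimes T (a T)) fun t ↦ f (a T / t).toNNReal) atTop
      (𝓝 (supAbs f)) := by
  have hle (T : ℕ) : maxAbs (halfTimes T (a T)) (fun t ↦ f (a T / t).toNNReal) ≤ supAbs f := by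
    refine maxAbs_le_supAbs hf _ fun t ht ↦ ?_
    rw [mem_halfTimes] at ht
    rw [Real.toNNReal_le_one]
    exact div_le_one_of_le₀ ht.2.2 (by positivity)
  refine tendsto_order.2 ⟨fun b hb ↦ ?_, fun b hb ↦ Eventually.of_forall fun T ↦
    (hle T).trans_lt hb⟩
  obtain ⟨⟨v, hv⟩, hbv⟩ := exists_lt_of_lt_ciSup hb
  have hcont : ContinuousOn (fun u ↦ |f u|) (Set.Icc 0 1) := hf.abs
  obtain ⟨u, hu0, hu1, hbu⟩ : ∃ u : ℝ≥0, 0 < u ∧ u ≤ 1 ∧ b < |f u| := by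
    have hcl : v ∈ closure (Set.Ioc (0 : ℝ≥0) 1) := by rwa [closure_Ioc zero_ne_one]
    have h1 := ((hcont v hv).mono Set.Ioc_subset_Icc_self).eventually_const_lt hbv
    have := mem_closure_iff_nhdsWithin_neBot.1 hcl
    obtain ⟨u, h2, h3⟩ := (h1.and self_mem_nhdsWithin).exists
    exact ⟨u, h3.1, h3.2, h2⟩
  have huR : (0 : ℝ) < u := hu0
  have hlim : Tendsto (fun T ↦ (a T / (⌈a T / u⌉₊ : ℝ)).toNNReal) atTop (𝓝 u) := by
    have h1 : Tendsto (fun T ↦ a T / u) atTop atTop := ha.tendsto_atTop.atTop_div_const huR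
    have h2 := (tendsto_nat_ceil_div_atTop (R := ℝ)).comp h1
    have h3 := (h2.inv₀ one_ne_zero).const_mul (u : ℝ)
    rw [inv_one, mul_one] at h3
    have h4 := (continuous_real_toNNReal.tendsto (u : ℝ)).comp h3
    rw [Real.toNNReal_coe] at h4
    refine h4.congr' ?_
    filter_upwards [ha.tendsto_atTop.eventually_gt_atTop 0] with T hT
    simp only [Function.comp_apply]
    congr 1
    field_simp
  have hev : ∀ᶠ T in atTop, ⌈a T / u⌉₊ ∈ halfTimes T (a T) := by
    have h5 : Tendsto (fun T : ℕ ↦ a T / T / u) atTop (𝓝 0) := by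
      simpa using ha.tendsto_div.div_const (u : ℝ)
    filter_upwards [ha.tendsto_atTop.eventually_ge_atTop 1, eventually_ge_atTop 4,
      h5.eventually_lt_const (show (0 : ℝ) < 1 / 4 by norm_num)] with T h1 hT4 h6
    rw [mem_halfTimes]
    have hTpos : (0 : ℝ) < T := by positivity
    have hau : a T ≤ a T / u := by
      rw [le_div_iff₀ huR]
      have : (u : ℝ) ≤ 1 := hu1
      nlinarith
    refine ⟨Nat.ceil_pos.2 (by positivity), ?_, hau.trans (Nat.le_ceil _)⟩
    have h7 : a T / u < T / 4 := by
      have : a T / u = a T / T / u * T := by field_simp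
      rw [this]
      linarith [mul_lt_mul_of_pos_right h6 hTpos]
    have h8 := Nat.ceil_lt_add_one (a := a T / u) (by positivity)
    have h9 : (4 : ℝ) ≤ T := by exact_mod_cast hT4
    have h10 : (2 * ⌈a T / u⌉₊ : ℝ) ≤ T := by linarith
    exact_mod_cast h10
  have hmem : ∀ᶠ T in atTop, (a T / (⌈a T / u⌉₊ : ℝ)).toNNReal ∈ Set.Icc (0 : ℝ≥0) 1 := by
    filter_upwards [hev] with T hT
    rw [mem_halfTimes] at hT
    exact ⟨zero_le, Real.toNNReal_le_one.2 (div_le_one_of_le₀ hT.2.2 (by positivity))⟩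
  have hfl := (hcont u ⟨hu0.le, hu1⟩).tendsto.comp (tendsto_nhdsWithin_iff.2 ⟨hlim, hmem⟩)
  filter_upwards [hfl.eventually_const_lt hbu, hev] with T h1 h2
  exact h1.trans_le (abs_le_maxAbs (fun t : ℕ ↦ f (a T / t).toNNReal) h2)

end Wiener

section Renyi

theorem sum_Icc_split (X : ℤ → ℝ) {t T : ℕ} (h : t ≤ T) :
    ∑ s ∈ Finset.Icc 1 T, X (s : ℤ) =
      ∑ s ∈ Finset.Icc 1 t, X (s : ℤ) + ∑ s ∈ Finset.Icc (t + 1) T, X (s : ℤ) := by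
  have h1 (n : ℕ) : Finset.Icc 1 n = Finset.Ioc 0 n := rfl
  have h2 : Finset.Icc (t + 1) T = Finset.Ioc t T := by ext; simp
  rw [h1, h1, h2, Finset.sum_Ioc_consecutive _ (Nat.zero_le t) h]

theorem abs_meanDiff_sub_le (X : ℤ → ℝ) {t T : ℕ} (h : 2 * t ≤ T) :
    |meanDiff X T t - 1 / (t : ℝ) * ∑ s ∈ Finset.Icc 1 t, X (s : ℤ)| ≤
      2 / T * (|∑ s ∈ Finset.Icc 1 T, X (s : ℤ)| + |∑ s ∈ Finset.Icc 1 t, X (s : ℤ)|) := by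
  have hR : 2 * (t : ℝ) ≤ T := by exact_mod_cast h
  have hsum := sum_Icc_split X (show t ≤ T by omega)
  rcases T.eq_zero_or_pos with rfl | hT
  · obtain rfl : t = 0 := by omega
    simp [meanDiff]
  have hTR : (0 : ℝ) < T := by exact_mod_cast hT
  have hle : 1 / ((T : ℝ) - t) ≤ 2 / T := by
    rw [div_le_div_iff₀ (by linarith) hTR]; linarith
  rw [meanDiff, sub_sub_cancel_left, abs_neg, abs_mul, abs_of_pos (one_div_pos.2 (by linarith))]
  refine mul_le_mul hle ?_ (abs_nonneg _) (by positivity)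
  rw [show ∑ s ∈ Finset.Icc (t + 1) T, X (s : ℤ) = ∑ s ∈ Finset.Icc 1 T, X (s : ℤ) -
    ∑ s ∈ Finset.Icc 1 t, X (s : ℤ) by linarith]
  exact abs_sub _ _

theorem abs_meanDiff_add_le (X : ℤ → ℝ) {t T : ℕ} (h : 2 * t ≤ T) :
    |meanDiff X T (T - t) + 1 / (t : ℝ) * ∑ s ∈ Finset.Icc (T - t + 1) T, X (s : ℤ)| ≤
      2 / T * (|∑ s ∈ Finset.Icc 1 T, X (s : ℤ)| +
        |∑ s ∈ Finset.Icc (T - t + 1) T, X (s : ℤ)|) := by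
  have hR : 2 * (t : ℝ) ≤ T := by exact_mod_cast h
  have hsum := sum_Icc_split X (show T - t ≤ T by omega)
  rcases T.eq_zero_or_pos with rfl | hT
  · obtain rfl : t = 0 := by omega
    simp [meanDiff]
  have hTR : (0 : ℝ) < T := by exact_mod_cast hT
  have hle : 1 / ((T : ℝ) - t) ≤ 2 / T := by
    rw [div_le_div_iff₀ (by linarith) hTR]; linarith
  rw [meanDiff, Nat.cast_sub (by omega), sub_sub_cancel, sub_add_cancel, abs_mul,
    abs_of_pos (one_div_pos.2 (by linarith))]
  refine mul_le_mul hle ?_ (abs_nonneg _) (by positivity)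
  rw [show ∑ s ∈ Finset.Icc 1 (T - t), X (s : ℤ) = ∑ s ∈ Finset.Icc 1 T, X (s : ℤ) -
    ∑ s ∈ Finset.Icc (T - t + 1) T, X (s : ℤ) by linarith]
  exact abs_sub _ _

open scoped Classical in
/-- The times over which the Rényi statistic is maximized. -/
noncomputable def renyiTimes (T : ℕ) (a : ℝ) : Finset ℕ :=
  (Finset.Icc 1 (T - 1)).filter fun t : ℕ ↦ a ≤ (t : ℝ) ∧ (t : ℝ) ≤ (T : ℝ) - a

theorem renyi_eq_maxAbs (X : ℤ → ℝ) (T : ℕ) (a : ℝ) :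
    renyi X T a = maxAbs (renyiTimes T a) (meanDiff X T) := rfl

theorem renyiTimes_eq (T : ℕ) (a : ℝ) :
    renyiTimes T a = halfTimes T a ∪ (halfTimes T a).image fun t ↦ T - t := by
  ext t
  simp only [renyiTimes, Finset.mem_filter, Finset.mem_Icc, Finset.mem_union, Finset.mem_image,
    mem_halfTimes]
  constructor
  · rintro ⟨⟨h1, h2⟩, h3, h4⟩
    by_cases h : 2 * t ≤ T
    · exact Or.inl ⟨h1, h, h3⟩
    · refine Or.inr ⟨T - t, ⟨by omega, by omega, ?_⟩, by omega⟩
      rw [Nat.cast_sub (by omega)]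
      linarith
  · rintro (⟨h1, h2, h3⟩ | ⟨s, ⟨h1, h2, h3⟩, rfl⟩)
    · have : 2 * (t : ℝ) ≤ T := by exact_mod_cast h2
      exact ⟨⟨h1, by omega⟩, h3, by linarith⟩
    · have : 2 * (s : ℝ) ≤ T := by exact_mod_cast h2
      rw [Nat.cast_sub (by omega)]
      exact ⟨⟨by omega, by omega⟩, by linarith, by linarith⟩

theorem abs_mul_renyi_sub_le {X : ℤ → ℝ} {T : ℕ} {a c B ε : ℝ} (hc : 0 ≤ c) (hB : 0 ≤ B)
    (hε : 0 ≤ ε) {p r : ℕ → ℝ} (hST : |∑ s ∈ Finset.Icc 1 T, X (s : ℤ)| ≤ B)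
    (hS : ∀ t ∈ halfTimes T a, |∑ s ∈ Finset.Icc 1 t, X (s : ℤ)| ≤ B)
    (hV : ∀ t ∈ halfTimes T a, |∑ s ∈ Finset.Icc (T - t + 1) T, X (s : ℤ)| ≤ B)
    (hp : ∀ t ∈ halfTimes T a,
      |c * (1 / (t : ℝ) * ∑ s ∈ Finset.Icc 1 t, X (s : ℤ)) - p t| ≤ ε)
    (hr : ∀ t ∈ halfTimes T a,
      |c * (1 / (t : ℝ) * ∑ s ∈ Finset.Icc (T - t + 1) T, X (s : ℤ)) - r t| ≤ ε) :
    |c * renyi X T a - max (maxAbs (halfTimes T a) p) (maxAbs (halfTimes T a) r)| ≤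
      ε + c * (4 / T * B) := by
  have hcB : 0 ≤ c * (4 / T * B) := by positivity
  rw [renyi_eq_maxAbs, renyiTimes_eq, maxAbs_union, maxAbs_image, mul_max_of_nonneg _ _ hc]
  refine (abs_max_sub_max_le_max _ _ _ _).trans (max_le ?_ ?_)
  · rw [← abs_of_nonneg hc, ← maxAbs_const_mul, abs_of_nonneg hc]
    refine abs_maxAbs_sub_le (by positivity) fun t ht ↦ ?_
    have h1 := abs_meanDiff_sub_le X (mem_halfTimes.1 ht).2.1
    have h2 : |c * (meanDiff X T t - 1 / (t : ℝ) * ∑ s ∈ Finset.Icc 1 t, X (s : ℤ))| ≤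
        c * (4 / T * B) := by
      rw [abs_mul, abs_of_nonneg hc]
      refine mul_le_mul_of_nonneg_left (h1.trans ?_) hc
      calc _ ≤ 2 / (T : ℝ) * (B + B) := by gcongr; exact hS t ht
        _ = 4 / T * B := by ring
    have h3 := abs_add_le (c * (1 / (t : ℝ) * ∑ s ∈ Finset.Icc 1 t, X (s : ℤ)) - p t)
      (c * (meanDiff X T t - 1 / (t : ℝ) * ∑ s ∈ Finset.Icc 1 t, X (s : ℤ)))
    have h4 := hp t ht
    rw [show c * meanDiff X T t - p t = c * (1 / (t : ℝ) * ∑ s ∈ Finset.Icc 1 t, X (s : ℤ)) - p t +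
      c * (meanDiff X T t - 1 / (t : ℝ) * ∑ s ∈ Finset.Icc 1 t, X (s : ℤ)) by ring]
    linarith
  · rw [← abs_of_nonneg hc, ← maxAbs_const_mul, abs_of_nonneg hc,
      maxAbs_congr (g := fun t ↦ -(c * (meanDiff X T ∘ fun t ↦ T - t) t)) (by simp)]
    refine abs_maxAbs_sub_le (by positivity) fun t ht ↦ ?_
    have h1 := abs_meanDiff_add_le X (mem_halfTimes.1 ht).2.1
    set v := ∑ s ∈ Finset.Icc (T - t + 1) T, X (s : ℤ)
    have h2 : |c * (meanDiff X T (T - t) + 1 / (t : ℝ) * v)| ≤ c * (4 / T * B) := by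
      rw [abs_mul, abs_of_nonneg hc]
      refine mul_le_mul_of_nonneg_left (h1.trans ?_) hc
      calc _ ≤ 2 / (T : ℝ) * (B + B) := by gcongr; exact hV t ht
        _ = 4 / T * B := by ring
    have h3 := abs_sub (c * (1 / (t : ℝ) * v) - r t)
      (c * (meanDiff X T (T - t) + 1 / (t : ℝ) * v))
    have h4 := hr t ht
    simp only [Function.comp_apply]
    rw [show -(c * meanDiff X T (T - t)) - r t = c * (1 / (t : ℝ) * v) - r t -
      c * (meanDiff X T (T - t) + 1 / (t : ℝ) * v) by ring]
    linarith

end Renyi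

section Limit

variable {Ω Ω' : Type*} [MeasurableSpace Ω] [MeasurableSpace Ω'] {P : Measure Ω} {P' : Measure Ω'}

theorem tendstoInDistribution_of_forall_identDistrib {Ω₁ Ω₂ : Type*} [MeasurableSpace Ω₁]
    [MeasurableSpace Ω₂] {P₁ : Measure Ω₁} {P₂ : Measure Ω₂} [IsProbabilityMeasure P]
    [IsProbabilityMeasure P'] [IsProbabilityMeasure P₁] [IsProbabilityMeasure P₂]
    {X : ℕ → Ω → ℝ} {X' : ℕ → Ω' → ℝ} {Z : Ω₁ → ℝ} {Z' : Ω₂ → ℝ}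
    (h : TendstoInDistribution X' atTop Z' (fun _ ↦ P') P₂)
    (hX : ∀ T, IdentDistrib (X T) (X' T) P P') (hZ : IdentDistrib Z Z' P₁ P₂) :
    TendstoInDistribution X atTop Z (fun _ ↦ P) P₁ where
  forall_aemeasurable T := (hX T).aemeasurable_fst
  aemeasurable_limit := hZ.aemeasurable_fst
  tendsto := by
    have h1 := h.tendsto
    convert! h1 using 2
    · congr 1
      funext T
      exact Subtype.ext (hX T).map_eq
    · simp only [hZ.map_eq]

theorem identDistrib_pair_of_indepFun {Ω₁ Ω₂ : Type*} [MeasurableSpace Ω₁] [MeasurableSpace Ω₂]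
    {P₁ : Measure Ω₁} {P₂ : Measure Ω₂} [IsProbabilityMeasure P] [IsProbabilityMeasure P₁]
    [IsProbabilityMeasure P₂] {X Y : Ω → ℝ} {X' : Ω₁ → ℝ} {Y' : Ω₂ → ℝ}
    (hX : IdentDistrib X X' P P₁) (hY : IdentDistrib Y Y' P P₂) (h : IndepFun X Y P) :
    IdentDistrib (fun ω ↦ (X ω, Y ω)) (fun q ↦ (X' q.1, Y' q.2)) P (P₁.prod P₂) := by
  have h1 : IdentDistrib X (fun q : Ω₁ × Ω₂ ↦ X' q.1) P (P₁.prod P₂) :=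
    hX.trans ⟨hX.aemeasurable_snd, hX.aemeasurable_snd.comp_fst, by
      rw [← Function.comp_def X' Prod.fst, ← AEMeasurable.map_map_of_aemeasurable
        (by simpa using hX.aemeasurable_snd) (by fun_prop)]
      simp⟩
  have h2 : IdentDistrib Y (fun q : Ω₁ × Ω₂ ↦ Y' q.2) P (P₁.prod P₂) :=
    hY.trans ⟨hY.aemeasurable_snd, hY.aemeasurable_snd.comp_snd, by
      rw [← Function.comp_def Y' Prod.snd, ← AEMeasurable.map_map_of_aemeasurable
        (by simpa using hY.aemeasurable_snd) (by fun_prop)]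
      simp⟩
  exact h1.prodMk h2 h (indepFun_prod₀ hX.aemeasurable_snd hY.aemeasurable_snd)

end Limit

section WienerLimit

variable {Ω Ω₁ Ω₂ : Type*} [MeasurableSpace Ω] [MeasurableSpace Ω₁] [MeasurableSpace Ω₂]
  {P : Measure Ω} {P₁ : Measure Ω₁} {P₂ : Measure Ω₂}

namespace IsWienerOn

theorem identDistrib_maxAbs_halfTimes {T : ℕ} {V : ℝ≥0 → Ω → ℝ} {W : ℝ≥0 → Ω₁ → ℝ}
    (hV : IsWienerOn P ((T : ℝ≥0) / 2) V) (hW : IsWienerOn P₁ 1 W) (a : ℝ) :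
    IdentDistrib (fun ω ↦ maxAbs (halfTimes T a) fun t : ℕ ↦ Real.sqrt a / t * V t ω)
      (fun ω ↦ maxAbs (halfTimes T a) fun t : ℕ ↦ W (a / t).toNNReal ω) P P₁ := by
  refine hV.identDistrib_maxAbs hW (halfTimes T a) (τ := fun t ↦ (t : ℝ≥0))
    (u := fun t : ℕ ↦ (a / t).toNNReal) (c := fun t ↦ Real.sqrt a / t) (fun t ht ↦ ?_)
    (fun t ht ↦ ?_) fun s hs t ht ↦ ?_
  · rw [mem_halfTimes] at ht
    rw [le_div_iff₀ (by norm_num)]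
    have : t * 2 ≤ T := by omega
    exact_mod_cast this
  · rw [mem_halfTimes] at ht
    exact Real.toNNReal_le_one.2 (div_le_one_of_le₀ ht.2.2 (by positivity))
  · rw [mem_halfTimes] at hs ht
    have hs0 : (0 : ℝ) < s := by exact_mod_cast hs.1
    have ht0 : (0 : ℝ) < t := by exact_mod_cast ht.1
    rcases le_or_gt a 0 with ha | ha
    · have h1 : (a / s).toNNReal = 0 :=
        Real.toNNReal_eq_zero.2 (div_nonpos_of_nonpos_of_nonneg ha hs0.le)
      rw [Real.sqrt_eq_zero_of_nonpos ha, h1]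
      simp
    · rw [NNReal.coe_min, NNReal.coe_min, Real.coe_toNNReal _ (by positivity),
        Real.coe_toNNReal _ (by positivity)]
      have hsq := Real.mul_self_sqrt ha.le
      rcases le_total (s : ℝ) t with hst | hst
      · have h2 : a / t ≤ a / s := by gcongr
        rw [min_eq_right h2]
        simp only [NNReal.coe_natCast, min_eq_left hst]
        field_simp
        linear_combination hsq
      · have h2 : a / s ≤ a / t := by gcongr
        rw [min_eq_left h2]
        simp only [NNReal.coe_natCast, min_eq_right hst]
        field_simp
        linear_combination hsq

/-- The running maximum of a Wiener process on `[0, T/2]` is of order `√T` in probability. -/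
theorem boundedInProb_maxAbs {V : ℕ → ℝ≥0 → Ω → ℝ} {W : ℝ≥0 → Ω₁ → ℝ} [IsProbabilityMeasure P₁]
    (hV : ∀ T : ℕ, IsWienerOn P ((T : ℝ≥0) / 2) (V T)) (hW : IsWienerOn P₁ 1 W)
    (hWm : AEMeasurable (fun ω ↦ supAbs (W · ω)) P₁) (G : ℕ → Finset ℝ≥0)
    (hG : ∀ T : ℕ, ∀ τ ∈ G T, τ ≤ (T : ℝ≥0) / 2) :
    BoundedInProb P fun q ↦ maxAbs (G q.1) fun τ ↦ 1 / Real.sqrt q.1 * V q.1 τ q.2 := by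
  have hle {T : ℕ} (hT : 1 ≤ T) {τ : ℝ≥0} (hτ : τ ∈ G T) : τ / T ≤ 1 := by
    refine div_le_one_of_le₀ ((hG T τ hτ).trans ?_) zero_le
    exact div_le_self zero_le one_le_two
  refine boundedInProb_of_identDistrib hWm
    (fun T ω ↦ maxAbs (G T) fun τ ↦ W (τ / T) ω) ?_ ?_
  · filter_upwards [eventually_ge_atTop 1] with T hT
    refine (hV T).identDistrib_maxAbs hW (G T) (τ := id) (u := fun τ ↦ τ / T)
      (c := fun _ ↦ 1 / Real.sqrt T) (hG T) (fun τ hτ ↦ hle hT hτ) fun τ _ τ' _ ↦ ?_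
    have hT0 : (0 : ℝ) < T := by exact_mod_cast hT
    have hsq := Real.mul_self_sqrt hT0.le
    have hne : Real.sqrt T ≠ 0 := (Real.sqrt_pos.2 hT0).ne'
    have h1 : 1 / Real.sqrt T * (1 / Real.sqrt T) = (T : ℝ)⁻¹ := by
      rw [div_mul_div_comm, hsq, one_mul, one_div]
    rw [h1]
    simp only [id_eq, NNReal.coe_min, NNReal.coe_div, NNReal.coe_natCast]
    rw [min_div_div_right hT0.le, inv_mul_eq_div]
  · filter_upwards [eventually_ge_atTop 1] with T hT
    filter_upwards [hW.cont] with ω hω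
    rw [abs_maxAbs]
    exact maxAbs_le_supAbs hω _ fun τ hτ ↦ hle hT hτ

end IsWienerOn

/-- The maxima of two independent rescaled Wiener processes converge in distribution. -/
theorem tendstoInDistribution_max_maxAbs_halfTimes [IsProbabilityMeasure P]
    [IsProbabilityMeasure P₁] [IsProbabilityMeasure P₂] {V₁ V₂ : ℕ → ℝ≥0 → Ω → ℝ}
    (hV₁ : ∀ T : ℕ, IsWienerOn P ((T : ℝ≥0) / 2) (V₁ T))
    (hV₂ : ∀ T : ℕ, IsWienerOn P ((T : ℝ≥0) / 2) (V₂ T))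
    (hind : ∀ T : ℕ, IndepFun (fun ω (u : Set.Icc (0 : ℝ≥0) ((T : ℝ≥0) / 2)) ↦ V₁ T u ω)
      (fun ω (u : Set.Icc (0 : ℝ≥0) ((T : ℝ≥0) / 2)) ↦ V₂ T u ω) P)
    {W : ℝ≥0 → Ω₁ → ℝ} (hW : IsWienerOn P₁ 1 W) {ξ₁ ξ₂ : Ω₂ → ℝ}
    (hξ₁ : IdentDistrib ξ₁ (fun ω ↦ supAbs (W · ω)) P₂ P₁)
    (hξ₂ : IdentDistrib ξ₂ (fun ω ↦ supAbs (W · ω)) P₂ P₁)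
    (hξ : IndepFun ξ₁ ξ₂ P₂) {a : ℕ → ℝ} (ha : TrimmingCondition a) :
    TendstoInDistribution
      (fun (T : ℕ) ω ↦
        max (maxAbs (halfTimes T (a T)) fun t : ℕ ↦ Real.sqrt (a T) / t * V₁ T t ω)
          (maxAbs (halfTimes T (a T)) fun t : ℕ ↦ Real.sqrt (a T) / t * V₂ T t ω))
      atTop (fun ω ↦ max (ξ₁ ω) (ξ₂ ω)) (fun _ ↦ P) P₂ := by
  have hmax : Measurable fun z : ℝ × ℝ ↦ max z.1 z.2 := measurable_fst.max measurable_snd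
  set A : ℕ → Ω₁ → ℝ := fun T ω ↦
    maxAbs (halfTimes T (a T)) fun t : ℕ ↦ W (a T / t).toNNReal ω with hA
  have hAm (T : ℕ) : AEMeasurable (A T) P₁ :=
    ((hV₁ T).identDistrib_maxAbs_halfTimes hW (a T)).aemeasurable_snd
  have hSm : AEMeasurable (fun ω ↦ supAbs (W · ω)) P₁ := hξ₁.aemeasurable_snd
  have hlim : TendstoInDistribution (fun (T : ℕ) (q : Ω₁ × Ω₁) ↦ max (A T q.1) (A T q.2)) atTop
      (fun q ↦ max (supAbs (W · q.1)) (supAbs (W · q.2))) (fun _ ↦ P₁.prod P₁) (P₁.prod P₁) := by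
    refine tendstoInDistribution_of_ae_tendsto (fun T ↦ (hAm T).comp_fst.max (hAm T).comp_snd)
      (hSm.comp_fst.max hSm.comp_snd) ?_
    have hae : ∀ᵐ ω ∂P₁, Tendsto (fun T ↦ A T ω) atTop (𝓝 (supAbs (W · ω))) := by
      filter_upwards [hW.cont] with ω hω using tendsto_maxAbs_halfTimes hω ha
    filter_upwards [Measure.quasiMeasurePreserving_fst.ae hae,
      Measure.quasiMeasurePreserving_snd.ae hae] with q h1 h2
    exact h1.max h2
  refine tendstoInDistribution_of_forall_identDistrib hlim (fun T ↦ ?_)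
    ((identDistrib_pair_of_indepFun hξ₁ hξ₂ hξ).comp hmax)
  classical
  have hφ : Measurable fun z : Set.Icc (0 : ℝ≥0) ((T : ℝ≥0) / 2) → ℝ ↦
      maxAbs (halfTimes T (a T)) fun t : ℕ ↦ Real.sqrt (a T) / t *
        if h : (t : ℝ≥0) ∈ Set.Icc (0 : ℝ≥0) ((T : ℝ≥0) / 2) then z ⟨t, h⟩ else 0 := by
    refine measurable_maxAbs _ fun t _ ↦ Measurable.const_mul ?_ _
    split_ifs
    · fun_prop
    · fun_prop
  have hin {t : ℕ} (ht : t ∈ halfTimes T (a T)) :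
      (t : ℝ≥0) ∈ Set.Icc (0 : ℝ≥0) ((T : ℝ≥0) / 2) := by
    rw [mem_halfTimes] at ht
    refine ⟨zero_le, ?_⟩
    rw [le_div_iff₀ (by norm_num)]
    have : t * 2 ≤ T := by omega
    exact_mod_cast this
  have hrw (V : ℝ≥0 → Ω → ℝ) (ω : Ω) :
      (maxAbs (halfTimes T (a T)) fun t : ℕ ↦ Real.sqrt (a T) / t *
        if (t : ℝ≥0) ∈ Set.Icc (0 : ℝ≥0) ((T : ℝ≥0) / 2) then V t ω else 0) =
      maxAbs (halfTimes T (a T)) fun t : ℕ ↦ Real.sqrt (a T) / t * V t ω :=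
    maxAbs_congr fun t ht ↦ by rw [if_pos (hin ht)]
  have hind' := (hind T).comp hφ hφ
  simp only [Function.comp_def, dite_eq_ite, hrw] at hind'
  exact (identDistrib_pair_of_indepFun ((hV₁ T).identDistrib_maxAbs_halfTimes hW (a T))
    ((hV₂ T).identDistrib_maxAbs_halfTimes hW (a T)) hind').comp hmax

end WienerLimit

section StrongApproximation

/-- The integers in `[1, T / 2]` and the midpoint `T / 2`. -/
noncomputable def halfGrid (T : ℕ) : Finset ℝ≥0 :=
  (Finset.Icc 1 (T / 2)).image (fun t : ℕ ↦ (t : ℝ≥0)) ∪ {(T : ℝ≥0) / 2}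

theorem le_of_mem_halfGrid {T : ℕ} {τ : ℝ≥0} (h : τ ∈ halfGrid T) : τ ≤ (T : ℝ≥0) / 2 := by
  simp only [halfGrid, Finset.mem_union, Finset.mem_image, Finset.mem_Icc,
    Finset.mem_singleton] at h
  rcases h with ⟨t, ht, rfl⟩ | rfl
  · rw [le_div_iff₀ (by norm_num)]
    have : t * 2 ≤ T := by omega
    exact_mod_cast this
  · exact le_rfl

theorem natCast_mem_halfGrid {T t : ℕ} {a : ℝ} (h : t ∈ halfTimes T a) :
    (t : ℝ≥0) ∈ halfGrid T := by
  rw [mem_halfTimes] at h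
  exact Finset.mem_union_left _ (Finset.mem_image_of_mem _ (Finset.mem_Icc.2 ⟨h.1, by omega⟩))

theorem half_mem_halfGrid (T : ℕ) : (T : ℝ≥0) / 2 ∈ halfGrid T :=
  Finset.mem_union_right _ (by simp)

variable {e : ℤ → ℝ} {σ κ a R₁ R₂ : ℝ} {T : ℕ} {w₁ w₂ : ℝ≥0 → ℝ}

/-- The partial sums are dominated by the maxima of the approximating paths and the errors. -/
theorem abs_le_of_approx (hσ : 0 < σ) (hκ : 0 < κ) (hR₁ : 0 ≤ R₁) {S : ℝ} {x τ : ℝ≥0}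
    (hτ : τ ∈ halfGrid T) (hxT : x ≤ T) (h : |S - σ * w₁ τ| ≤ (x : ℝ) ^ κ * R₁) :
    |S| ≤ σ * maxAbs (halfGrid T) w₁ + (T : ℝ) ^ κ * R₁ := by
  have h1 := abs_le_maxAbs w₁ hτ
  have h2 : (x : ℝ) ^ κ ≤ (T : ℝ) ^ κ :=
    Real.rpow_le_rpow x.coe_nonneg (by exact_mod_cast hxT) hκ.le
  have h3 := abs_sub_abs_le_abs_sub S (σ * w₁ τ)
  rw [abs_mul, abs_of_pos hσ] at h3
  have h4 := mul_le_mul_of_nonneg_left h1 hσ.le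
  have h5 := mul_le_mul_of_nonneg_right h2 hR₁
  linarith

theorem abs_scaled_sub_le (hσ : 0 < σ) (hκ : κ < 1 / 2) (hR : 0 ≤ R₁) (ha : 1 ≤ a) {t : ℕ}
    (ht : a ≤ t) {S w : ℝ} (h : |S - σ * w| ≤ (t : ℝ) ^ κ * R₁) :
    |Real.sqrt a / σ * (1 / (t : ℝ) * S) - Real.sqrt a / t * w| ≤ a ^ (κ - 1 / 2) / σ * R₁ := by
  have ha0 : 0 < a := by linarith
  have ht0 : (0 : ℝ) < t := by linarith
  have h1 : Real.sqrt a / σ * (1 / (t : ℝ) * S) - Real.sqrt a / t * w =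
      Real.sqrt a / (σ * t) * (S - σ * w) := by field_simp
  rw [h1, abs_mul, abs_of_nonneg (by positivity)]
  calc Real.sqrt a / (σ * t) * |S - σ * w| ≤ Real.sqrt a / (σ * t) * ((t : ℝ) ^ κ * R₁) := by gcongr
    _ = Real.sqrt a * (t : ℝ) ^ (κ - 1) / σ * R₁ := by
      rw [Real.rpow_sub_one ht0.ne']; field_simp
    _ ≤ Real.sqrt a * a ^ (κ - 1) / σ * R₁ := by
      have := Real.rpow_le_rpow_of_nonpos ha0 ht (show κ - 1 ≤ 0 by linarith)
      gcongr
    _ = a ^ (κ - 1 / 2) / σ * R₁ := by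
      rw [Real.sqrt_eq_rpow, ← Real.rpow_add ha0]
      ring_nf

theorem abs_renyi_sub_le_of_approx (hσ : 0 < σ) (hκ0 : 0 < κ) (hκ : κ < 1 / 2) (hR₁ : 0 ≤ R₁)
    (hR₂ : 0 ≤ R₂) (ha : 1 ≤ a) (hT : 2 ≤ T)
    (h₁ : ∀ x ∈ Set.Icc (1 : ℝ≥0) ((T : ℝ≥0) / 2),
      |(∑ s ∈ Finset.Icc 1 ⌊x⌋₊, e (s : ℤ)) - σ * w₁ x| ≤ (x : ℝ) ^ κ * R₁)
    (h₂ : ∀ x ∈ Set.Icc ((T : ℝ≥0) / 2) ((T : ℝ≥0) - 1),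
      |(∑ s ∈ Finset.Icc (⌊x⌋₊ + 1) T, e (s : ℤ)) - σ * w₂ ((T : ℝ≥0) - x)| ≤
        ((T : ℝ) - x) ^ κ * R₂) :
    |∑ s ∈ Finset.Icc 1 T, e (s : ℤ)| ≤
      σ * (maxAbs (halfGrid T) w₁ + maxAbs (halfGrid T) w₂) + (T : ℝ) ^ κ * (R₁ + R₂) ∧
    |Real.sqrt a / σ * renyi e T a -
      max (maxAbs (halfTimes T a) fun t : ℕ ↦ Real.sqrt a / t * w₁ t)
        (maxAbs (halfTimes T a) fun t : ℕ ↦ Real.sqrt a / t * w₂ t)| ≤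
      a ^ (κ - 1 / 2) / σ * (R₁ + R₂) + Real.sqrt a / σ * (4 / T *
        (σ * (maxAbs (halfGrid T) w₁ + maxAbs (halfGrid T) w₂) + (T : ℝ) ^ κ * (R₁ + R₂))) := by
  have hM₁ := maxAbs_nonneg (halfGrid T) w₁
  have hM₂ := maxAbs_nonneg (halfGrid T) w₂
  have hTκ : 0 ≤ (T : ℝ) ^ κ := by positivity
  have haκ : 0 ≤ a ^ (κ - 1 / 2) / σ := by positivity
  have hTR : (2 : ℝ≥0) ≤ T := by exact_mod_cast hT
  have hTR' : (2 : ℝ) ≤ T := by exact_mod_cast hT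
  have hhalf : (T : ℝ≥0) / 2 ≤ T := NNReal.half_le_self _
  have hsub : (T : ℝ≥0) - (T : ℝ≥0) / 2 = (T : ℝ≥0) / 2 :=
    tsub_eq_of_eq_add (add_halves _).symm
  have hmem1 : (T : ℝ≥0) / 2 ∈ Set.Icc (1 : ℝ≥0) ((T : ℝ≥0) / 2) :=
    ⟨by rw [le_div_iff₀ (by norm_num)]; simpa using hTR, le_rfl⟩
  have hmem2 : (T : ℝ≥0) / 2 ∈ Set.Icc ((T : ℝ≥0) / 2) ((T : ℝ≥0) - 1) := by
    refine ⟨le_rfl, ?_⟩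
    rw [le_tsub_iff_right (by linarith)]
    rw [← NNReal.coe_le_coe]
    push_cast
    linarith
  have hA := abs_le_of_approx hσ hκ0 hR₁ (half_mem_halfGrid T) hhalf (h₁ _ hmem1)
  have hB : |∑ s ∈ Finset.Icc (⌊(T : ℝ≥0) / 2⌋₊ + 1) T, e (s : ℤ)| ≤
      σ * maxAbs (halfGrid T) w₂ + (T : ℝ) ^ κ * R₂ := by
    have h := h₂ _ hmem2
    rw [hsub] at h
    refine abs_le_of_approx (x := (T : ℝ≥0) / 2) hσ hκ0 hR₂ (half_mem_halfGrid T)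
      hhalf ?_
    convert h using 3
    push_cast
    ring
  have hfl : ⌊(T : ℝ≥0) / 2⌋₊ ≤ T :=
    Nat.floor_le_of_le hhalf
  have hST : |∑ s ∈ Finset.Icc 1 T, e (s : ℤ)| ≤
      σ * (maxAbs (halfGrid T) w₁ + maxAbs (halfGrid T) w₂) + (T : ℝ) ^ κ * (R₁ + R₂) := by
    rw [sum_Icc_split e hfl]
    refine (abs_add_le _ _).trans ((add_le_add hA hB).trans (le_of_eq (by ring)))
  refine ⟨hST, ?_⟩
  have hS' (t : ℕ) (ht : t ∈ halfTimes T a) :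
      |(∑ s ∈ Finset.Icc 1 t, e (s : ℤ)) - σ * w₁ t| ≤ (t : ℝ) ^ κ * R₁ := by
    have h := h₁ t ⟨by exact_mod_cast (mem_halfTimes.1 ht).1,
      le_of_mem_halfGrid (natCast_mem_halfGrid ht)⟩
    rw [Nat.floor_natCast] at h
    exact_mod_cast h
  have hV' (t : ℕ) (ht : t ∈ halfTimes T a) :
      |(∑ s ∈ Finset.Icc (T - t + 1) T, e (s : ℤ)) - σ * w₂ t| ≤ (t : ℝ) ^ κ * R₂ := by
    obtain ⟨ht1, ht2, -⟩ := mem_halfTimes.1 ht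
    have hcast : ((T - t : ℕ) : ℝ≥0) = (T : ℝ≥0) - t := Nat.cast_tsub T t
    have htT : (t : ℝ≥0) ≤ T := by exact_mod_cast (show t ≤ T by omega)
    have hmem : ((T - t : ℕ) : ℝ≥0) ∈ Set.Icc ((T : ℝ≥0) / 2) ((T : ℝ≥0) - 1) := by
      constructor
      · rw [div_le_iff₀ (by norm_num)]
        exact_mod_cast (show T ≤ (T - t) * 2 by omega)
      · rw [hcast]
        exact tsub_le_tsub_left (by exact_mod_cast ht1) _
    have h := h₂ _ hmem
    rw [Nat.floor_natCast, hcast, tsub_tsub_cancel_of_le htT, NNReal.coe_sub htT] at h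
    simpa using h
  have hle {t : ℕ} (ht : t ∈ halfTimes T a) : (t : ℝ≥0) ≤ T :=
    (le_of_mem_halfGrid (natCast_mem_halfGrid ht)).trans hhalf
  refine abs_mul_renyi_sub_le (by positivity) (by positivity) (by positivity) hST
    (fun t ht ↦ ?_) (fun t ht ↦ ?_) (fun t ht ↦ ?_) fun t ht ↦ ?_
  · have := abs_le_of_approx (x := t) hσ hκ0 hR₁ (natCast_mem_halfGrid ht) (hle ht)
      (by exact_mod_cast hS' t ht)
    nlinarith [mul_nonneg hσ.le hM₂, mul_nonneg hTκ hR₂]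
  · have := abs_le_of_approx (x := t) hσ hκ0 hR₂ (natCast_mem_halfGrid ht) (hle ht)
      (by exact_mod_cast hV' t ht)
    nlinarith [mul_nonneg hσ.le hM₁, mul_nonneg hTκ hR₁]
  · refine (abs_scaled_sub_le hσ hκ hR₁ ha (mem_halfTimes.1 ht).2.2 (hS' t ht)).trans ?_
    nlinarith [mul_nonneg haκ hR₂]
  · refine (abs_scaled_sub_le hσ hκ hR₂ ha (mem_halfTimes.1 ht).2.2 (hV' t ht)).trans ?_
    nlinarith [mul_nonneg haκ hR₁]

end StrongApproximation

section Limit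

variable {Ω Ω₁ Ω₂ : Type*} [MeasurableSpace Ω] [MeasurableSpace Ω₁] [MeasurableSpace Ω₂]
  {P : Measure Ω} {P₁ : Measure Ω₁} {P₂ : Measure Ω₂}

theorem le_rpow_mul_of_iSup_ne_top {s : Set ℝ≥0} {y h : ℝ≥0 → ℝ} {κ : ℝ}
    (hfin : ⨆ x ∈ s, ENNReal.ofReal (y x ^ (-κ) * h x) ≠ ∞) {x : ℝ≥0} (hx : x ∈ s) (hy : 0 < y x) :
    h x ≤ y x ^ κ * (⨆ x ∈ s, ENNReal.ofReal (y x ^ (-κ) * h x)).toReal := by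
  have h1 : ENNReal.ofReal (y x ^ (-κ) * h x) ≤ ⨆ x ∈ s, ENNReal.ofReal (y x ^ (-κ) * h x) :=
    le_iSup₂ (f := fun x (_ : x ∈ s) ↦ ENNReal.ofReal (y x ^ (-κ) * h x)) x hx
  have h2 := ENNReal.ofReal_le_iff_le_toReal hfin |>.1 h1
  have hpos : 0 < y x ^ κ := Real.rpow_pos_of_pos hy κ
  rw [Real.rpow_neg hy.le, inv_mul_le_iff₀ hpos] at h2
  exact h2

theorem StrongApproximation.tendsto_renyi [IsProbabilityMeasure P] [IsProbabilityMeasure P₁]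
    [IsProbabilityMeasure P₂] {e : ℤ → Ω → ℝ} {σ : ℝ} (hσ : 0 < σ)
    (h : StrongApproximation P e σ) {a : ℕ → ℝ} (ha : TrimmingCondition a)
    {W : ℝ≥0 → Ω₁ → ℝ} (hW : IsWienerOn P₁ 1 W) {ξ₁ ξ₂ : Ω₂ → ℝ}
    (hξ₁ : IdentDistrib ξ₁ (fun ω ↦ supAbs (W · ω)) P₂ P₁)
    (hξ₂ : IdentDistrib ξ₂ (fun ω ↦ supAbs (W · ω)) P₂ P₁) (hξ : IndepFun ξ₁ ξ₂ P₂) :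
    (∃ X : ℕ → Ω → ℝ,
      TendstoInDistribution X atTop (fun ω ↦ max (ξ₁ ω) (ξ₂ ω)) (fun _ ↦ P) P₂ ∧
      Tendsto (fun q : ℕ × Ω ↦ Real.sqrt (a q.1) / σ * renyi (fun s ↦ e s q.2) q.1 (a q.1) -
        X q.1 q.2) (whp P) (𝓝 0)) ∧
    Tendsto (fun q : ℕ × Ω ↦ Real.sqrt (a q.1) / q.1 * |∑ s ∈ Finset.Icc 1 q.1, e (s : ℤ) q.2|)
      (whp P) (𝓝 0) := by
  obtain ⟨κ, hκ0, hκ, V₁, V₂, hV₁, hV₂, hind, hO₁, hO₂⟩ := h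
  set Z₁ : ℕ → Ω → ℝ≥0∞ := fun T ω ↦ ⨆ x ∈ Set.Icc (1 : ℝ≥0) ((T : ℝ≥0) / 2),
    ENNReal.ofReal ((x : ℝ) ^ (-κ) *
      |(∑ s ∈ Finset.Icc 1 ⌊x⌋₊, e (s : ℤ) ω) - σ * V₁ T x ω|) with hZ₁
  set Z₂ : ℕ → Ω → ℝ≥0∞ := fun T ω ↦ ⨆ x ∈ Set.Icc ((T : ℝ≥0) / 2) ((T : ℝ≥0) - 1),
    ENNReal.ofReal (((T : ℝ) - (x : ℝ)) ^ (-κ) *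
      |(∑ s ∈ Finset.Icc (⌊x⌋₊ + 1) T, e (s : ℤ) ω) - σ * V₂ T ((T : ℝ≥0) - x) ω|) with hZ₂
  have hSm := hξ₁.aemeasurable_snd
  have hM₁ := IsWienerOn.boundedInProb_maxAbs hV₁ hW hSm halfGrid fun _ _ ↦ le_of_mem_halfGrid
  have hM₂ := IsWienerOn.boundedInProb_maxAbs hV₂ hW hSm halfGrid fun _ _ ↦ le_of_mem_halfGrid
  have hR := hO₁.boundedInProb.add hO₂.boundedInProb
  have hM := hM₁.add hM₂
  have ha1 : Tendsto (fun T ↦ a T ^ (κ - 1 / 2) / σ) atTop (𝓝 0) := by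
    have h1 := (tendsto_rpow_neg_atTop (show 0 < 1 / 2 - κ by linarith)).comp ha.tendsto_atTop
    simpa using h1.div_const σ
  have ha2 : Tendsto (fun T : ℕ ↦ Real.sqrt (a T / T)) atTop (𝓝 0) := by
    simpa using ha.tendsto_div.sqrt
  have ha3 : Tendsto (fun T : ℕ ↦ (T : ℝ) ^ (κ - 1 / 2)) atTop (𝓝 0) := by
    have h1 := (tendsto_rpow_neg_atTop (show 0 < 1 / 2 - κ by linarith)).comp
      (tendsto_natCast_atTop_atTop (R := ℝ))
    simpa [Function.comp_def] using h1
  set B : ℕ × Ω → ℝ := fun q ↦ σ * (maxAbs (halfGrid q.1) (V₁ q.1 · q.2) +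
    maxAbs (halfGrid q.1) (V₂ q.1 · q.2)) +
      (q.1 : ℝ) ^ κ * ((Z₁ q.1 q.2).toReal + (Z₂ q.1 q.2).toReal) with hB
  have hev : ∀ᶠ q : ℕ × Ω in whp P, 1 ≤ a q.1 ∧ 2 ≤ q.1 :=
    eventually_whp_of_atTop ((ha.tendsto_atTop.eventually_ge_atTop 1).and (eventually_ge_atTop 2))
  have hBlim : Tendsto (fun q : ℕ × Ω ↦ Real.sqrt (a q.1) / q.1 * B q) (whp P) (𝓝 0) := by
    have h1 := hM.mul_tendsto_zero
      (tendsto_whp_of_atTop (P := P) (by simpa only [mul_zero] using ha2.const_mul σ))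
    have h2 := hR.mul_tendsto_zero
      (tendsto_whp_of_atTop (P := P) (by simpa only [mul_zero] using ha2.mul ha3))
    have h3 := h1.add h2
    rw [add_zero] at h3
    refine h3.congr' ?_
    filter_upwards [hev] with q hq
    have hT0 : (0 : ℝ) < q.1 := by exact_mod_cast (by omega : 0 < q.1)
    have ha0 : 0 ≤ a q.1 := by linarith [hq.1]
    have hs : Real.sqrt q.1 ≠ 0 := (Real.sqrt_pos.2 hT0).ne'
    simp only [maxAbs_const_mul, abs_of_nonneg (one_div_nonneg.2 (Real.sqrt_nonneg (q.1 : ℝ))), hB]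
    have hsq := Real.mul_self_sqrt hT0.le
    have h4 : Real.sqrt (a q.1 / q.1) = Real.sqrt (a q.1) / Real.sqrt q.1 := Real.sqrt_div' _ hT0.le
    have h5 : (q.1 : ℝ) ^ (κ - 1 / 2) = (q.1 : ℝ) ^ κ / Real.sqrt q.1 := by
      rw [Real.rpow_sub hT0, Real.sqrt_eq_rpow]
    have h6 : Real.sqrt (a q.1) / q.1 =
        Real.sqrt (a q.1) / (Real.sqrt q.1 * Real.sqrt q.1) := by rw [hsq]
    rw [h4, h5, h6]
    field_simp
  have hmain : ∀ᶠ q : ℕ × Ω in whp P, |∑ s ∈ Finset.Icc 1 q.1, e (s : ℤ) q.2| ≤ B q ∧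
      |Real.sqrt (a q.1) / σ * renyi (fun s ↦ e s q.2) q.1 (a q.1) -
        max (maxAbs (halfTimes q.1 (a q.1)) fun t : ℕ ↦ Real.sqrt (a q.1) / t * V₁ q.1 t q.2)
          (maxAbs (halfTimes q.1 (a q.1)) fun t : ℕ ↦ Real.sqrt (a q.1) / t * V₂ q.1 t q.2)| ≤
        a q.1 ^ (κ - 1 / 2) / σ * ((Z₁ q.1 q.2).toReal + (Z₂ q.1 q.2).toReal) +
          Real.sqrt (a q.1) / σ * (4 / q.1 * B q) := by
    filter_upwards [hev, hO₁.ne_top, hO₂.ne_top] with ⟨T, ω⟩ hq h1 h2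
    refine abs_renyi_sub_le_of_approx (e := fun s ↦ e s ω) (R₁ := (Z₁ T ω).toReal)
      (R₂ := (Z₂ T ω).toReal) hσ hκ0 hκ ENNReal.toReal_nonneg ENNReal.toReal_nonneg hq.1
      hq.2 (w₁ := (V₁ T · ω)) (w₂ := (V₂ T · ω)) (fun x hx ↦ ?_) fun x hx ↦ ?_
    · exact le_rpow_mul_of_iSup_ne_top (y := fun x ↦ (x : ℝ))
        (h := fun x ↦ |(∑ s ∈ Finset.Icc 1 ⌊x⌋₊, e (s : ℤ) ω) - σ * V₁ T x ω|) h1 hx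
        (zero_lt_one.trans_le (by exact_mod_cast hx.1))
    · have hT1 : (1 : ℝ≥0) ≤ T := by exact_mod_cast (by omega : 1 ≤ T)
      have hx1 : (x : ℝ) ≤ T - 1 := by
        have := NNReal.coe_le_coe.2 hx.2
        rwa [NNReal.coe_sub hT1, NNReal.coe_natCast, NNReal.coe_one] at this
      exact le_rpow_mul_of_iSup_ne_top (y := fun x ↦ (T : ℝ) - x)
        (h := fun x ↦ |(∑ s ∈ Finset.Icc (⌊x⌋₊ + 1) T, e (s : ℤ) ω) -
          σ * V₂ T ((T : ℝ≥0) - x) ω|) h2 hx (by linarith)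
  refine ⟨⟨_, tendstoInDistribution_max_maxAbs_halfTimes hV₁ hV₂ hind hW hξ₁ hξ₂ hξ ha, ?_⟩, ?_⟩
  · have h1 := hR.mul_tendsto_zero (tendsto_whp_of_atTop (P := P) ha1)
    have h2 := h1.add (hBlim.const_mul (4 / σ))
    rw [mul_zero, add_zero] at h2
    refine squeeze_zero_norm' ?_ h2
    filter_upwards [hmain] with q hq
    refine hq.2.trans (le_of_eq ?_)
    ring
  · refine squeeze_zero_norm' ?_ hBlim
    filter_upwards [hmain] with q hq
    rw [Real.norm_eq_abs, abs_of_nonneg (by positivity)]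
    exact mul_le_mul_of_nonneg_left hq.1 (by positivity)

end Limit

/-- A compact subset of the line with finitely many components is locally an interval. -/
theorem exists_convex_inter_ball {Θ : Set ℝ} (hΘ : IsCompact Θ)
    (hfin : Finite (ConnectedComponents Θ)) {θ : ℝ} (hθ : θ ∈ Θ) :
    ∃ δ > 0, Convex ℝ (Θ ∩ Metric.ball θ δ) := by
  have := isCompact_iff_compactSpace.1 hΘ
  have hopen : IsOpen (connectedComponent (⟨θ, hθ⟩ : Θ)) := by
    rw [← connectedComponents_preimage_singleton]
    exact (isOpen_discrete _).preimage ConnectedComponents.continuous_coe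
  obtain ⟨δ, hδ, hsub⟩ := Metric.isOpen_iff.1 hopen ⟨θ, hθ⟩ mem_connectedComponent
  refine ⟨δ, hδ, ?_⟩
  set C : Set ℝ := (↑) '' connectedComponent (⟨θ, hθ⟩ : Θ)
  have hC : C.OrdConnected :=
    (isPreconnected_connectedComponent.image _ continuous_subtype_val.continuousOn).ordConnected
  have heq : Θ ∩ Metric.ball θ δ = C ∩ Metric.ball θ δ := by
    ext z
    constructor
    · rintro ⟨hz, hzb⟩
      exact ⟨⟨⟨z, hz⟩, hsub hzb, rfl⟩, hzb⟩
    · rintro ⟨⟨w, -, rfl⟩, hzb⟩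
      exact ⟨w.2, hzb⟩
  rw [heq, Real.ball_eq_Ioo]
  exact (hC.inter Set.ordConnected_Ioo).convex

/-- A measurable supremum of `φ y z` over `z ∈ K`, for a family which is continuous on `K`. -/
theorem exists_measurable_iSup {E X : Type*} [MeasurableSpace E] [TopologicalSpace X]
    [TopologicalSpace.PseudoMetrizableSpace X] [SecondCountableTopology X] (K : Set X)
    (φ : E → X → ℝ) (hφ : ∀ z ∈ K, Measurable fun y ↦ φ y z) :
    ∃ R : E → ℝ≥0∞, Measurable R ∧
      (∀ y C, (∀ z ∈ K, ENNReal.ofReal (φ y z) ≤ C) → R y ≤ C) ∧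
      ∀ y, ContinuousOn (φ y) K → ∀ z ∈ K, ENNReal.ofReal (φ y z) ≤ R y := by
  obtain ⟨D, hDK, hD, hKD⟩ :=
    (TopologicalSpace.IsSeparable.of_separableSpace K).exists_countable_dense_subset
  refine ⟨fun y ↦ ⨆ z ∈ D, ENNReal.ofReal (φ y z),
    Measurable.biSup D hD fun z hz ↦ (hφ z (hDK hz)).ennreal_ofReal,
    fun y C h ↦ iSup₂_le fun z hz ↦ h z (hDK hz), fun y hy z hz ↦ ?_⟩
  have hcont : ContinuousWithinAt (fun z ↦ ENNReal.ofReal (φ y z)) D z :=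
    ENNReal.continuous_ofReal.continuousAt.comp_continuousWithinAt ((hy z hz).mono hDK)
  have hmem := hcont.mem_closure_image (hKD hz)
  have hsub : (fun z ↦ ENNReal.ofReal (φ y z)) '' D ⊆
      Set.Iic (⨆ z ∈ D, ENNReal.ofReal (φ y z)) := by
    rintro _ ⟨w, hw, rfl⟩
    exact le_iSup₂ (f := fun z (_ : z ∈ D) ↦ ENNReal.ofReal (φ y z)) w hw
  exact closure_minimal hsub isClosed_Iic hmem

section Moments

variable {Ω E : Type*} [MeasurableSpace Ω] [MeasurableSpace E] {P : Measure Ω}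
  {x : ℤ → Ω → E} {g : E → ℝ → ℝ} {Θ : Set ℝ} {θ₀ : ℝ}

theorem IsStationaryErgodic.ae_of_ae_zero (hx : IsStationaryErgodic P x) {s : Set E}
    (hs : MeasurableSet s) (h : ∀ᵐ ω ∂P, x 0 ω ∈ s) : ∀ᵐ ω ∂P, ∀ t, x t ω ∈ s := by
  rw [ae_all_iff]
  intro t
  exact (hx.identDistrib 0 t).ae_mem_snd hs h

/-- Around every parameter the moment functions are Lipschitz, with an integrable constant which
depends on the observation only. -/
theorem MomentRegularity.exists_lipschitz (hx : IsStationaryErgodic P x) (hΘ : IsCompact Θ)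
    (hfin : Finite (ConnectedComponents Θ)) (hg : ∀ θ ∈ Θ, Measurable fun y ↦ g y θ)
    (h : MomentRegularity P Θ (fun t θ ω ↦ g (x t ω) θ) θ₀) {θ : ℝ} (hθ : θ ∈ Θ) :
    ∃ δ > 0, ∃ lip : E → ℝ, Measurable lip ∧ (∀ y, 0 ≤ lip y) ∧
      Integrable (fun ω ↦ lip (x 0 ω)) P ∧
      ∀ᵐ ω ∂P, ∀ t, ∀ u ∈ Θ ∩ Metric.ball θ δ, ∀ v ∈ Θ ∩ Metric.ball θ δ,
        |g (x t ω) u - g (x t ω) v| ≤ lip (x t ω) * |u - v| := by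
  obtain ⟨δ, hδ, hconv⟩ := exists_convex_inter_ball hΘ hfin hθ
  set I := Θ ∩ Metric.ball θ δ with hI
  set K : Set (ℝ × ℝ) := {z | z.1 ∈ I ∧ z.2 ∈ I ∧ z.1 ≠ z.2} with hK
  obtain ⟨R, hRm, hRle, hleR⟩ := exists_measurable_iSup K
    (fun y z ↦ |g y z.1 - g y z.2| / |z.1 - z.2|)
    fun z hz ↦ (((hg _ hz.1.1).sub (hg _ hz.2.1.1)).abs).div_const _
  obtain ⟨M, hMi, hM⟩ := h.deriv_bound
  have hRM : ∀ᵐ ω ∂P, R (x 0 ω) ≤ ENNReal.ofReal (M ω) := by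
    filter_upwards [hM, h.differentiable 0] with ω hω hd
    refine hRle _ _ fun z hz ↦ ENNReal.ofReal_le_ofReal ?_
    have hne : 0 < |z.1 - z.2| := abs_pos.2 (sub_ne_zero.2 hz.2.2)
    rw [div_le_iff₀ hne]
    exact hconv.norm_image_sub_le_of_norm_hasDerivWithin_le
      (fun v hv ↦ ((hd v hv.1).hasDerivWithinAt).mono Set.inter_subset_left)
      (fun v hv ↦ hω v hv.1) hz.2.1 hz.1
  have hlint : ∫⁻ ω, R (x 0 ω) ∂P ≠ ∞ :=
    ((lintegral_mono_ae hRM).trans_lt (hMi.lintegral_lt_top)).ne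
  have hRx : Measurable fun ω ↦ R (x 0 ω) := hRm.comp (hx.measurable 0)
  refine ⟨δ, hδ, fun y ↦ (R y).toReal, hRm.ennreal_toReal, fun _ ↦ ENNReal.toReal_nonneg,
    integrable_toReal_of_lintegral_ne_top hRx.aemeasurable hlint, ?_⟩
  have hfinite := hx.ae_of_ae_zero (s := {y | R y < ∞}) (measurableSet_lt hRm measurable_const)
    (ae_lt_top hRx hlint)
  filter_upwards [hfinite, ae_all_iff.2 h.differentiable] with ω hω hd t u hu v hv
  rcases eq_or_ne u v with rfl | huv
  · simp
  have hc : ContinuousOn (g (x t ω)) I := (hd t).continuousOn.mono Set.inter_subset_left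
  have hcont : ContinuousOn (fun z : ℝ × ℝ ↦ |g (x t ω) z.1 - g (x t ω) z.2| / |z.1 - z.2|) K := by
    refine ContinuousOn.div ?_ (by fun_prop) fun z hz ↦ (abs_pos.2 (sub_ne_zero.2 hz.2.2)).ne'
    exact ((hc.comp continuousOn_fst fun z hz ↦ hz.1).sub
      (hc.comp continuousOn_snd fun z hz ↦ hz.2.1)).abs
  have h1 := hleR _ hcont (u, v) ⟨hu, hv, huv⟩
  rw [ENNReal.ofReal_le_iff_le_toReal (hω t).ne, div_le_iff₀ (abs_pos.2 (sub_ne_zero.2 huv))] at h1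
  exact h1

end Moments

theorem abs_mul_sum_sub_le {ι : Type*} (s : Finset ι) {w c : ℝ} (hw : 0 ≤ w) {a b l : ι → ℝ}
    (h : ∀ i ∈ s, |a i - b i| ≤ l i * c) :
    |w * ∑ i ∈ s, a i - w * ∑ i ∈ s, b i| ≤ (w * ∑ i ∈ s, l i) * c := by
  rw [← mul_sub, ← Finset.sum_sub_distrib, abs_mul, abs_of_nonneg hw, mul_assoc, Finset.sum_mul]
  exact mul_le_mul_of_nonneg_left ((Finset.abs_sum_le_sum_abs _ _).trans (Finset.sum_le_sum h)) hw

section Estimator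

variable {Ω E : Type*} [MeasurableSpace Ω] [MeasurableSpace E] {P : Measure Ω}
  {x : ℤ → Ω → E} {g : E → ℝ → ℝ} {Θ : Set ℝ} {θ₀ : ℝ}

/-- Evaluating a random continuous function at a random point gives a random variable. -/
theorem aemeasurable_eval_of_continuousOn {X : Ω → E} (hX : Measurable X)
    (hg : ∀ θ ∈ Θ, Measurable fun y ↦ g y θ) (hc : ∀ᵐ ω ∂P, ContinuousOn (g (X ω)) Θ)
    {f : Ω → ℝ} (hf : Measurable f) (hfΘ : ∀ ω, f ω ∈ Θ) :
    AEMeasurable (fun ω ↦ g (X ω) (f ω)) P := by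
  classical
  rcases isEmpty_or_nonempty Ω with hΩ | ⟨⟨ω₀⟩⟩
  · exact (measurable_of_empty _).aemeasurable
  set F := SimpleFunc.approxOn f hf Θ (f ω₀) (hfΘ ω₀)
  have hF (n : ℕ) (ω : Ω) : F n ω ∈ Θ := SimpleFunc.approxOn_mem hf (hfΘ ω₀) n ω
  have hm (n : ℕ) : Measurable fun ω ↦ g (X ω) (F n ω) := by
    have h1 := (F n).measurable_bind (fun θ ω ↦ if θ ∈ Θ then g (X ω) θ else 0) fun θ ↦ by
      split_ifs with hθ
      · exact (hg θ hθ).comp hX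
      · exact measurable_const
    simpa only [hF, if_true] using h1
  refine aemeasurable_of_tendsto_metrizable_ae atTop (fun n ↦ (hm n).aemeasurable) ?_
  filter_upwards [hc] with ω hω
  exact (hω (f ω) (hfΘ ω)).tendsto.comp (tendsto_nhdsWithin_iff.2
    ⟨SimpleFunc.tendsto_approxOn hf (hfΘ ω₀) (subset_closure (hfΘ ω)),
      Eventually.of_forall fun n ↦ hF n ω⟩)

/-- The sample average of the moment functions, for a sample of size `q.1` and an outcome `q.2`. -/
noncomputable def avgMoment (g : E → ℝ → ℝ) (x : ℤ → Ω → E) (q : ℕ × Ω) (θ : ℝ) : ℝ :=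
  1 / (q.1 : ℝ) * ∑ s ∈ Finset.Icc 1 q.1, g (x (s : ℤ) q.2) θ

variable [IsProbabilityMeasure P]

theorem eventually_avgMoment_ne_zero_nhds (hx : IsStationaryErgodic P x) (hΘ : IsCompact Θ)
    (hfin : Finite (ConnectedComponents Θ)) (hg : ∀ θ ∈ Θ, Measurable fun y ↦ g y θ)
    (h : MomentRegularity P Θ (fun t θ ω ↦ g (x t ω) θ) θ₀) {θ : ℝ} (hθ : θ ∈ Θ)
    (hne : ∫ ω, g (x 0 ω) θ ∂P ≠ 0) :
    ∃ ρ > 0, ∀ᶠ q in whp P, ∀ u ∈ Θ ∩ Metric.ball θ ρ, avgMoment g x q u ≠ 0 := by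
  obtain ⟨δ, hδ, lip, hlm, hl0, hli, hlip⟩ := h.exists_lipschitz hx hΘ hfin hg hθ
  set b := ∫ ω, g (x 0 ω) θ ∂P with hb
  set L := ∫ ω, lip (x 0 ω) ∂P with hL
  have hL0 : 0 ≤ L := integral_nonneg fun ω ↦ hl0 _
  have hb0 : 0 < |b| := abs_pos.2 hne
  have hLpos : 0 < 2 * (L + 1) := by positivity
  refine ⟨min δ (|b| / (2 * (L + 1))), lt_min hδ (by positivity), ?_⟩
  have h1 := hx.tendsto_average hlm hli
  have h2 := (hx.tendsto_average (hg θ hθ) (h.integrable θ hθ)).abs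
  filter_upwards [h1.eventually_lt_const (show L < L + 1 by linarith),
    h2.eventually_const_lt (show |b| / 2 < |b| by linarith),
    eventually_whp_of_ae (p := fun q ↦ ∀ t, ∀ u ∈ Θ ∩ Metric.ball θ δ,
      ∀ v ∈ Θ ∩ Metric.ball θ δ, |g (x t q.2) u - g (x t q.2) v| ≤ lip (x t q.2) * |u - v|)
      fun _ ↦ hlip] with q hq1 hq2 hq3 u hu hzero
  have huδ : u ∈ Θ ∩ Metric.ball θ δ :=
    ⟨hu.1, Metric.ball_subset_ball (min_le_left _ _) hu.2⟩
  have hur : |u - θ| < |b| / (2 * (L + 1)) := by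
    have := Metric.ball_subset_ball (min_le_right _ _) hu.2
    rwa [Metric.mem_ball, Real.dist_eq] at this
  have h3 := abs_mul_sum_sub_le (Finset.Icc 1 q.1) (w := 1 / (q.1 : ℝ)) (c := |u - θ|)
    (a := fun s : ℕ ↦ g (x s q.2) u) (b := fun s : ℕ ↦ g (x s q.2) θ)
    (l := fun s : ℕ ↦ lip (x s q.2)) (by positivity)
    fun s _ ↦ hq3 s u huδ θ ⟨hθ, Metric.mem_ball_self hδ⟩
  change |avgMoment g x q u - _| ≤ _ at h3
  rw [hzero, zero_sub, abs_neg] at h3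
  have h4 : (1 / (q.1 : ℝ) * ∑ s ∈ Finset.Icc 1 q.1, lip (x (s : ℤ) q.2)) * |u - θ| ≤
      (L + 1) * (|b| / (2 * (L + 1))) :=
    mul_le_mul hq1.le hur.le (abs_nonneg _) (by positivity)
  have h5 : (L + 1) * (|b| / (2 * (L + 1))) = |b| / 2 := by field_simp
  linarith

/-- Consistency of the estimator. -/
theorem eventually_abs_sub_lt (hx : IsStationaryErgodic P x) (hΘ : IsCompact Θ)
    (hfin : Finite (ConnectedComponents Θ)) (hg : ∀ θ ∈ Θ, Measurable fun y ↦ g y θ)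
    (h : MomentRegularity P Θ (fun t θ ω ↦ g (x t ω) θ) θ₀)
    (hid : Identifiable P Θ (fun t θ ω ↦ g (x t ω) θ) θ₀) {θhat : ℕ → Ω → ℝ}
    (hθhat : IsGMMEstimator P Θ (fun t θ ω ↦ g (x t ω) θ) θhat) {ε : ℝ} (hε : 0 < ε) :
    ∀ᶠ q in whp P, |θhat q.1 q.2 - θ₀| < ε := by
  have hK : IsCompact (Θ \ Metric.ball θ₀ ε) := hΘ.diff Metric.isOpen_ball
  have hev : ∀ᶠ q in whp P, ∀ u ∈ Θ \ Metric.ball θ₀ ε, avgMoment g x q u ≠ 0 := by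
    refine hK.induction_on (p := fun s ↦ ∀ᶠ q in whp P, ∀ u ∈ s, avgMoment g x q u ≠ 0) (by simp)
      (fun s t hst ht ↦ ht.mono fun q hq u hu ↦ hq u (hst hu)) (fun s t hs ht ↦ ?_)
      fun θ hθ ↦ ?_
    · filter_upwards [hs, ht] with q h1 h2 u hu
      exact hu.elim (h1 u) (h2 u)
    · have hne : θ ≠ θ₀ := by
        rintro rfl
        exact hθ.2 (Metric.mem_ball_self hε)
      obtain ⟨ρ, hρ, hev⟩ := eventually_avgMoment_ne_zero_nhds hx hΘ hfin hg h hθ.1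
        fun h0 ↦ hne ((hid θ hθ.1).1 h0)
      refine ⟨(Θ \ Metric.ball θ₀ ε) ∩ Metric.ball θ ρ,
        inter_mem self_mem_nhdsWithin (mem_nhdsWithin_of_mem_nhds (Metric.ball_mem_nhds θ hρ)),
        hev.mono fun q hq u hu ↦ hq u ⟨hu.1.1, hu.2⟩⟩
  have hsolve : ∀ᶠ q : ℕ × Ω in whp P,
      ∑ t ∈ Finset.Icc 1 q.1, g (x (t : ℤ) q.2) (θhat q.1 q.2) = 0 :=
    eventually_whp_iff.2 hθhat.solves
  filter_upwards [hev, hsolve] with q h1 h2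
  by_contra hcon
  refine h1 (θhat q.1 q.2) ⟨hθhat.mem _ _, fun hmem ↦ hcon ?_⟩ (by rw [avgMoment, h2, mul_zero])
  rwa [Metric.mem_ball, Real.dist_eq] at hmem

/-- Near `θ₀` the sample average of the moment functions grows at least linearly. -/
theorem eventually_le_abs_avgMoment_sub (hx : IsStationaryErgodic P x) (hΘ : IsCompact Θ)
    (hfin : Finite (ConnectedComponents Θ)) (hg : ∀ θ ∈ Θ, Measurable fun y ↦ g y θ)
    (h : MomentRegularity P Θ (fun t θ ω ↦ g (x t ω) θ) θ₀) (hθ₀ : θ₀ ∈ Θ) :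
    ∃ ρ > 0, ∃ c > 0, ∀ᶠ q in whp P, ∀ u ∈ Θ ∩ Metric.ball θ₀ ρ,
      c * |u - θ₀| ≤ |avgMoment g x q u - avgMoment g x q θ₀| := by
  obtain ⟨δ, hδ, lip, hlm, hl0, hli, hlip⟩ := h.exists_lipschitz hx hΘ hfin hg hθ₀
  obtain ⟨M, hMi, hM⟩ := h.deriv_bound
  set b := ∫ ω, derivWithin (fun θ ↦ g (x 0 ω) θ) Θ θ₀ ∂P with hb
  have hbne : b ≠ 0 := h.deriv_ne_zero.self_of_nhdsWithin hθ₀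
  have hb0 : 0 < |b| := abs_pos.2 hbne
  have hacc : (𝓝[Θ \ {θ₀}] θ₀).NeBot := by
    by_contra hcon
    refine hbne ?_
    have hzero (f : ℝ → ℝ) : derivWithin f Θ θ₀ = 0 :=
      derivWithin_zero_of_not_accPt fun hacc ↦ hcon (accPt_principal_iff_nhdsWithin.1 hacc)
    simp [hb, hzero]
  obtain ⟨v, hv⟩ := exists_seq_tendsto (𝓝[Θ \ {θ₀}] θ₀)
  have hvmem : ∀ᶠ n in atTop, v n ∈ Θ \ {θ₀} := (tendsto_nhdsWithin_iff.1 hv).2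
  have hd : ∀ᵐ ω ∂P, ∀ t, Tendsto (slope (g (x t ω)) θ₀) (𝓝[Θ \ {θ₀}] θ₀)
      (𝓝 (derivWithin (g (x t ω)) Θ θ₀)) := by
    filter_upwards [ae_all_iff.2 h.differentiable] with ω hω t
    exact hasDerivWithinAt_iff_tendsto_slope.1 ((hω t θ₀ hθ₀).hasDerivWithinAt)
  have hslope {u : ℝ} (hu : u ∈ Θ) : Measurable fun y ↦ slope (g y) θ₀ u := by
    simp only [slope_def_field]
    exact ((hg u hu).sub (hg θ₀ hθ₀)).div_const _
  -- a measurable version of the derivative at `θ₀`, as a function of the observation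
  obtain ⟨D, hDm, hD⟩ : ∃ D : E → ℝ, Measurable D ∧
      ∀ᵐ ω ∂P, ∀ t, D (x t ω) = derivWithin (g (x t ω)) Θ θ₀ := by
    classical
    set w : ℕ → ℝ := fun n ↦ if v n ∈ Θ \ {θ₀} then v n else θ₀ with hw
    have hwΘ (n : ℕ) : w n ∈ Θ := by
      by_cases hn : v n ∈ Θ \ {θ₀}
      · rw [hw]; simp only [hn, if_true]; exact hn.1
      · rw [hw]; simp only [hn, if_false]; exact hθ₀
    refine ⟨fun y ↦ limUnder atTop fun n ↦ slope (g y) θ₀ (w n),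
      (StronglyMeasurable.limUnder fun n ↦ (hslope (hwΘ n)).stronglyMeasurable).measurable, ?_⟩
    filter_upwards [hd] with ω hω t
    refine Tendsto.limUnder_eq (((hω t).comp hv).congr' ?_)
    filter_upwards [hvmem] with n hn
    simp only [hw, Function.comp_apply, if_pos hn]
  have hDi : Integrable (fun ω ↦ D (x 0 ω)) P := by
    refine hMi.mono' (hDm.comp (hx.measurable 0)).aestronglyMeasurable ?_
    filter_upwards [hD, hM] with ω h1 h2
    rw [h1 0]
    exact h2 θ₀ hθ₀
  have hDb : ∫ ω, D (x 0 ω) ∂P = b :=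
    integral_congr_ae (by filter_upwards [hD] with ω hω using hω 0)
  -- the oscillation of the slopes has a small mean
  set K : ℕ → Set ℝ := fun n ↦ (Θ ∩ Metric.ball θ₀ (1 / ((n : ℝ) + 1))) \ {θ₀} with hK
  have hex (n : ℕ) := exists_measurable_iSup (K n) (fun y u ↦ |slope (g y) θ₀ u - D y|)
    fun u hu ↦ ((hslope hu.1.1).sub hDm).abs
  choose R hRm hRle hleR using hex
  have hlimR : Tendsto (fun n ↦ ∫⁻ ω, R n (x 0 ω) ∂P) atTop (𝓝 0) := by
    have hmain := tendsto_lintegral_filter_of_dominated_convergence (μ := P) (l := atTop)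
      (F := fun n ω ↦ R n (x 0 ω)) (f := fun _ ↦ 0)
      (fun ω ↦ ENNReal.ofReal (lip (x 0 ω) + M ω))
      (Eventually.of_forall fun n ↦ (hRm n).comp (hx.measurable 0)) ?_
      (hli.add hMi).lintegral_lt_top.ne ?_
    · simpa using hmain
    · have hsmall := tendsto_one_div_add_atTop_nhds_zero_nat (𝕜 := ℝ)
      filter_upwards [hsmall.eventually_lt_const hδ] with n hn
      filter_upwards [hlip, hD, hM] with ω h1 h2 h3
      refine hRle n _ _ fun u hu ↦ ENNReal.ofReal_le_ofReal ?_
      have hu0 : 0 < |u - θ₀| := abs_pos.2 (sub_ne_zero.2 hu.2)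
      have h4 : |slope (g (x 0 ω)) θ₀ u| ≤ lip (x 0 ω) := by
        rw [slope_def_field, abs_div, div_le_iff₀ hu0]
        exact h1 0 u ⟨hu.1.1, Metric.ball_subset_ball hn.le hu.1.2⟩ θ₀
          ⟨hθ₀, Metric.mem_ball_self hδ⟩
      have h5 : |D (x 0 ω)| ≤ M ω := by
        rw [h2 0]
        exact h3 θ₀ hθ₀
      exact (abs_sub _ _).trans (add_le_add h4 h5)
    · filter_upwards [hd, hD] with ω h1 h2
      rw [ENNReal.tendsto_nhds_zero]
      intro ε hε
      rcases eq_or_ne ε ∞ with rfl | hεtop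
      · simp
      have hεpos : 0 < ε.toReal := ENNReal.toReal_pos hε.ne' hεtop
      have h3 := Metric.tendsto_nhds.1 (h1 0) ε.toReal hεpos
      rw [eventually_nhdsWithin_iff] at h3
      obtain ⟨r, hr, h4⟩ := Metric.eventually_nhds_iff_ball.1 h3
      filter_upwards [(tendsto_one_div_add_atTop_nhds_zero_nat (𝕜 := ℝ)).eventually_lt_const hr]
        with n hn
      refine hRle n _ _ fun u hu ↦ ENNReal.ofReal_le_of_le_toReal ?_
      have h5 := h4 u (Metric.ball_subset_ball hn.le hu.1.2) ⟨hu.1.1, hu.2⟩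
      rw [Real.dist_eq, ← h2 0] at h5
      exact h5.le
  obtain ⟨n, hn⟩ := (hlimR.eventually_lt_const
    (show (0 : ℝ≥0∞) < ENNReal.ofReal (|b| / 4) by simpa using hb0)).exists
  have hRx : Measurable fun ω ↦ R n (x 0 ω) := (hRm n).comp (hx.measurable 0)
  have hRtop : ∫⁻ ω, R n (x 0 ω) ∂P ≠ ∞ := (hn.trans ENNReal.ofReal_lt_top).ne
  have hRi : Integrable (fun ω ↦ (R n (x 0 ω)).toReal) P :=
    integrable_toReal_of_lintegral_ne_top hRx.aemeasurable hRtop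
  have hRint : ∫ ω, (R n (x 0 ω)).toReal ∂P < |b| / 4 := by
    rw [integral_toReal hRx.aemeasurable (ae_lt_top hRx hRtop)]
    exact (ENNReal.lt_ofReal_iff_toReal_lt hRtop).1 hn
  have hRfin := hx.ae_of_ae_zero (s := {y | R n y < ∞}) (measurableSet_lt (hRm n) measurable_const)
    (ae_lt_top hRx hRtop)
  have h1 := hx.tendsto_average (hRm n).ennreal_toReal hRi
  have h2 := (hx.tendsto_average hDm hDi).abs
  rw [hDb] at h2
  refine ⟨1 / ((n : ℝ) + 1), by positivity, |b| / 4, by positivity, ?_⟩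
  have hbound : ∀ᵐ ω ∂P, ∀ t, ∀ u ∈ K n,
      |slope (g (x t ω)) θ₀ u - D (x t ω)| ≤ (R n (x t ω)).toReal := by
    filter_upwards [hRfin, ae_all_iff.2 h.differentiable] with ω h3 h4 t u hu
    refine (ENNReal.ofReal_le_iff_le_toReal (h3 t).ne).1 (hleR n _ ?_ u hu)
    have hc : ContinuousOn (g (x t ω)) (K n) :=
      (h4 t).continuousOn.mono fun z hz ↦ hz.1.1
    refine ContinuousOn.abs (ContinuousOn.sub ?_ continuousOn_const)
    simp only [slope_fun_def_field]
    exact (hc.sub continuousOn_const).div (by fun_prop) fun z hz ↦ sub_ne_zero.2 hz.2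
  filter_upwards [h1.eventually_lt_const hRint,
    h2.eventually_const_lt (show |b| / 2 < |b| by linarith),
    eventually_whp_of_ae (p := fun q ↦ ∀ t, ∀ u ∈ K n,
      |slope (g (x t q.2)) θ₀ u - D (x t q.2)| ≤ (R n (x t q.2)).toReal) fun _ ↦ hbound]
    with q hq1 hq2 hq3 u hu
  rcases eq_or_ne u θ₀ with rfl | hne
  · simp
  have h3 := abs_mul_sum_sub_le (Finset.Icc 1 q.1) (w := 1 / (q.1 : ℝ)) (c := 1)
    (a := fun s : ℕ ↦ slope (g (x s q.2)) θ₀ u) (b := fun s : ℕ ↦ D (x s q.2))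
    (l := fun s : ℕ ↦ (R n (x s q.2)).toReal) (by positivity)
    fun s _ ↦ by simpa using hq3 s u ⟨hu, hne⟩
  rw [mul_one, abs_sub_comm] at h3
  have h4 := abs_sub_abs_le_abs_sub (1 / (q.1 : ℝ) * ∑ s ∈ Finset.Icc 1 q.1, D (x s q.2))
    (1 / (q.1 : ℝ) * ∑ s ∈ Finset.Icc 1 q.1, slope (g (x s q.2)) θ₀ u)
  have h5 : avgMoment g x q u - avgMoment g x q θ₀ =
      (1 / (q.1 : ℝ) * ∑ s ∈ Finset.Icc 1 q.1, slope (g (x s q.2)) θ₀ u) * (u - θ₀) := by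
    have hsub : u - θ₀ ≠ 0 := sub_ne_zero.2 hne
    simp only [avgMoment, slope_def_field, ← mul_sub, ← Finset.sum_sub_distrib, ← Finset.sum_div]
    field_simp
  rw [h5, abs_mul]
  exact mul_le_mul_of_nonneg_right (by linarith) (abs_nonneg _)

end Estimator

theorem abs_meanDiff_sub_meanDiff_le {X Y l : ℤ → ℝ} {c : ℝ} (hc : 0 ≤ c)
    (h : ∀ s, |X s - Y s| ≤ l s * c) {t T : ℕ} (ht : 1 ≤ t) (htT : t < T) :
    |meanDiff X T t - meanDiff Y T t| ≤
      (maxAbs (Finset.Icc 1 T) (fun t : ℕ ↦ 1 / (t : ℝ) * ∑ s ∈ Finset.Icc 1 t, l (s : ℤ)) +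
        maxAbs (Finset.range T) (fun t : ℕ ↦ 1 / ((T : ℝ) - t) *
          ∑ s ∈ Finset.Icc (t + 1) T, l (s : ℤ))) * c := by
  have htT' : (0 : ℝ) < (T : ℝ) - t := sub_pos.2 (by exact_mod_cast htT)
  have h1 := abs_mul_sum_sub_le (Finset.Icc 1 t) (w := 1 / (t : ℝ)) (by positivity)
    (a := fun s : ℕ ↦ X s) (b := fun s : ℕ ↦ Y s) (l := fun s : ℕ ↦ l s) fun s _ ↦ h s
  have h2 := abs_mul_sum_sub_le (Finset.Icc (t + 1) T) (w := 1 / ((T : ℝ) - t)) (by positivity)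
    (a := fun s : ℕ ↦ X s) (b := fun s : ℕ ↦ Y s) (l := fun s : ℕ ↦ l s) fun s _ ↦ h s
  have h3 := (le_abs_self _).trans (abs_le_maxAbs (s := Finset.Icc 1 T)
    (fun t : ℕ ↦ 1 / (t : ℝ) * ∑ s ∈ Finset.Icc 1 t, l (s : ℤ)) (Finset.mem_Icc.2 ⟨ht, htT.le⟩))
  have h4 := (le_abs_self _).trans (abs_le_maxAbs (s := Finset.range T)
    (fun t : ℕ ↦ 1 / ((T : ℝ) - t) * ∑ s ∈ Finset.Icc (t + 1) T, l (s : ℤ))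
    (Finset.mem_range.2 htT))
  have h5 := h1.trans (mul_le_mul_of_nonneg_right h3 hc)
  have h6 := h2.trans (mul_le_mul_of_nonneg_right h4 hc)
  have h7 (p q r s : ℝ) : |p - q - (r - s)| ≤ |p - r| + |q - s| := by
    rw [show p - q - (r - s) = p - r - (q - s) by ring]
    exact abs_sub _ _
  rw [add_mul]
  exact (h7 _ _ _ _).trans (add_le_add h5 h6)

theorem abs_renyi_sub_renyi_le {X Y l : ℤ → ℝ} {c : ℝ} (hc : 0 ≤ c)
    (h : ∀ s, |X s - Y s| ≤ l s * c) (T : ℕ) (a : ℝ) :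
    |renyi X T a - renyi Y T a| ≤
      (maxAbs (Finset.Icc 1 T) (fun t : ℕ ↦ 1 / (t : ℝ) * ∑ s ∈ Finset.Icc 1 t, l (s : ℤ)) +
        maxAbs (Finset.range T) (fun t : ℕ ↦ 1 / ((T : ℝ) - t) *
          ∑ s ∈ Finset.Icc (t + 1) T, l (s : ℤ))) * c := by
  rw [renyi_eq_maxAbs, renyi_eq_maxAbs]
  refine abs_maxAbs_sub_le
    (mul_nonneg (add_nonneg (maxAbs_nonneg _ _) (maxAbs_nonneg _ _)) hc) fun t ht ↦ ?_
  simp only [renyiTimes, Finset.mem_filter, Finset.mem_Icc] at ht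
  exact abs_meanDiff_sub_meanDiff_le hc h ht.1.1 (by omega)

section Estimator

variable {Ω E : Type*} [MeasurableSpace Ω] [MeasurableSpace E] {P : Measure Ω}
  {x : ℤ → Ω → E} {g : E → ℝ → ℝ} {Θ : Set ℝ} {θ₀ : ℝ}

theorem aemeasurable_renyi {X : ℤ → Ω → ℝ} (hX : ∀ s, AEMeasurable (X s) P) (T : ℕ) (a : ℝ) :
    AEMeasurable (fun ω ↦ renyi (fun s ↦ X s ω) T a) P := by
  simp only [renyi_eq_maxAbs]
  refine aemeasurable_maxAbs _ fun t _ ↦ ?_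
  unfold meanDiff
  exact ((Finset.aemeasurable_fun_sum _ fun (s : ℕ) _ ↦ hX s).const_mul _).fun_sub
    ((Finset.aemeasurable_fun_sum _ fun (s : ℕ) _ ↦ hX s).const_mul _)

variable [IsProbabilityMeasure P]

/-- Replacing `θ₀` by the estimator does not change the limit of the Rényi statistic. -/
theorem tendsto_renyi_sub_renyi (hx : IsStationaryErgodic P x) (hΘ : IsCompact Θ)
    (hfin : Finite (ConnectedComponents Θ)) (hg : ∀ θ ∈ Θ, Measurable fun y ↦ g y θ)
    (h : MomentRegularity P Θ (fun t θ ω ↦ g (x t ω) θ) θ₀) (hθ₀ : θ₀ ∈ Θ)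
    (hid : Identifiable P Θ (fun t θ ω ↦ g (x t ω) θ) θ₀) {θhat : ℕ → Ω → ℝ}
    (hθhat : IsGMMEstimator P Θ (fun t θ ω ↦ g (x t ω) θ) θhat) {a : ℕ → ℝ}
    (hsum : Tendsto (fun q : ℕ × Ω ↦ Real.sqrt (a q.1) / q.1 *
      |∑ s ∈ Finset.Icc 1 q.1, g (x (s : ℤ) q.2) θ₀|) (whp P) (𝓝 0)) :
    Tendsto (fun q : ℕ × Ω ↦ Real.sqrt (a q.1) *
      (renyi (fun s ↦ g (x s q.2) (θhat q.1 q.2)) q.1 (a q.1) -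
        renyi (fun s ↦ g (x s q.2) θ₀) q.1 (a q.1))) (whp P) (𝓝 0) := by
  obtain ⟨δ, hδ, lip, hlm, hl0, hli, hlip⟩ := h.exists_lipschitz hx hΘ hfin hg hθ₀
  obtain ⟨ρ, hρ, c, hc, hlin⟩ := eventually_le_abs_avgMoment_sub hx hΘ hfin hg h hθ₀
  have hsolve : ∀ᶠ q : ℕ × Ω in whp P,
      ∑ t ∈ Finset.Icc 1 q.1, g (x (t : ℤ) q.2) (θhat q.1 q.2) = 0 :=
    eventually_whp_iff.2 hθhat.solves
  have hrate : Tendsto (fun q : ℕ × Ω ↦ Real.sqrt (a q.1) * |θhat q.1 q.2 - θ₀|) (whp P)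
      (𝓝 0) := by
    refine squeeze_zero_norm' ?_ (by simpa only [mul_zero] using hsum.const_mul c⁻¹)
    filter_upwards [hlin, hsolve, eventually_abs_sub_lt hx hΘ hfin hg h hid hθhat hρ]
      with q h1 h2 h3
    have h4 := h1 (θhat q.1 q.2)
      ⟨hθhat.mem _ _, by rwa [Metric.mem_ball, Real.dist_eq]⟩
    rw [avgMoment, h2, mul_zero, zero_sub, abs_neg, avgMoment, abs_mul,
      abs_of_nonneg (show 0 ≤ 1 / (q.1 : ℝ) by positivity), ← le_inv_mul_iff₀ hc] at h4
    rw [Real.norm_eq_abs, abs_mul, abs_abs, abs_of_nonneg (Real.sqrt_nonneg _)]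
    refine (mul_le_mul_of_nonneg_left h4 (Real.sqrt_nonneg _)).trans (le_of_eq ?_)
    ring
  have hO := (hx.boundedInProb_maxAbs_average_fst hlm hl0 hli).add
    (hx.boundedInProb_maxAbs_average_snd hlm hl0 hli)
  refine squeeze_zero_norm' ?_ (hO.mul_tendsto_zero hrate)
  filter_upwards [eventually_abs_sub_lt hx hΘ hfin hg h hid hθhat hδ,
    eventually_whp_of_ae (p := fun q ↦ ∀ t, ∀ u ∈ Θ ∩ Metric.ball θ₀ δ,
      ∀ v ∈ Θ ∩ Metric.ball θ₀ δ, |g (x t q.2) u - g (x t q.2) v| ≤ lip (x t q.2) * |u - v|)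
      fun _ ↦ hlip] with q h1 h2
  have h3 := abs_renyi_sub_renyi_le (abs_nonneg (θhat q.1 q.2 - θ₀))
    (fun s ↦ h2 s _ ⟨hθhat.mem _ _, by rwa [Metric.mem_ball, Real.dist_eq]⟩ θ₀
      ⟨hθ₀, Metric.mem_ball_self hδ⟩) q.1 (a q.1)
  rw [Real.norm_eq_abs, abs_mul, abs_of_nonneg (Real.sqrt_nonneg _)]
  refine (mul_le_mul_of_nonneg_left h3 (Real.sqrt_nonneg _)).trans (le_of_eq ?_)
  ring

end Estimator

end GMM

theorem theorem3p3
    {Ω : Type*} [MeasurableSpace Ω] (P : Measure Ω) [IsProbabilityMeasure P]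
    {d : ℕ} (x : ℤ → Ω → EuclideanSpace ℝ (Fin d)) (hx : ∀ t, Measurable (x t))
    (hx_dep : GMM.StationaryErgodicDecay P x)
    (Θ : Set ℝ) (hΘ : IsCompact Θ) (hΘ_comp : Finite (ConnectedComponents Θ))
    (g : EuclideanSpace ℝ (Fin d) → ℝ → ℝ) (hg : ∀ θ ∈ Θ, Measurable (fun y ↦ g y θ))
    (θ₀ : ℝ) (hH₀ : GMM.NullHypothesis P Θ (GMM.moment g x) θ₀)
    (hident : GMM.Identifiable P Θ (GMM.moment g x) θ₀)
    (hreg : GMM.MomentRegularity P Θ (GMM.moment g x) θ₀)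
    (σ : ℝ) (hσ : 0 < σ)
    (happrox : GMM.StrongApproximation P (fun s ↦ GMM.moment g x s θ₀) σ)
    (θhat : ℕ → Ω → ℝ) (hθhat : GMM.IsGMMEstimator P Θ (GMM.moment g x) θhat)
    (tT : ℕ → ℝ) (htT : GMM.TrimmingCondition tT)
    -- the limit: `ξ = sup_{0 ≤ u ≤ 1} |W(u)|`, and independent `ξ₁`, `ξ₂` distributed as `ξ`
    {Ω₁ : Type*} [MeasurableSpace Ω₁] (P₁ : Measure Ω₁) [IsProbabilityMeasure P₁]
    (W : ℝ≥0 → Ω₁ → ℝ) (hW : GMM.IsWienerOn P₁ 1 W)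
    {Ω₂ : Type*} [MeasurableSpace Ω₂] (P₂ : Measure Ω₂) [IsProbabilityMeasure P₂]
    (ξ₁ ξ₂ : Ω₂ → ℝ)
    (hξ₁ : IdentDistrib ξ₁ (fun ω ↦ ⨆ u : Set.Icc (0 : ℝ≥0) 1, |W u ω|) P₂ P₁)
    (hξ₂ : IdentDistrib ξ₂ (fun ω ↦ ⨆ u : Set.Icc (0 : ℝ≥0) 1, |W u ω|) P₂ P₁)
    (hξ : IndepFun ξ₁ ξ₂ P₂) :
    TendstoInDistribution
      (fun (T : ℕ) (ω : Ω) ↦ Real.sqrt (tT T) / σ *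
        GMM.renyi (fun s ↦ GMM.moment g x s (θhat T ω) ω) T (tT T))
      atTop (fun ω ↦ max (ξ₁ ω) (ξ₂ ω)) (fun _ ↦ P) P₂ := by
  have hse : GMM.IsStationaryErgodic P x := ⟨hx, hx_dep.ergodic⟩
  obtain ⟨⟨X, hX, hXsub⟩, hsum⟩ := happrox.tendsto_renyi hσ htT hW hξ₁ hξ₂ hξ
  have hdiff := GMM.tendsto_renyi_sub_renyi hse hΘ hΘ_comp hg hreg hH₀.mem hident hθhat
    (a := tT) hsum
  refine tendstoInDistribution_of_tendstoInMeasure_sub _ _ hX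
    (GMM.tendstoInMeasure_of_whp (c := 0) ?_) fun T ↦ ?_
  · have hlim := hXsub.add (hdiff.const_mul (1 / σ))
    rw [mul_zero, add_zero] at hlim
    refine hlim.congr fun q ↦ ?_
    simp only [Pi.sub_apply, GMM.moment]
    ring
  · refine (GMM.aemeasurable_renyi (fun s ↦ ?_) T (tT T)).const_mul _
    refine GMM.aemeasurable_eval_of_continuousOn (hx s) hg ?_ (hθhat.measurable T) (hθhat.mem T)
    filter_upwards [hreg.differentiable s] with ω hω using hω.continuousOn
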